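/- Setting. There are $K\ge 2$ arms and $T\ge 2$ rounds. Let $\mathcal G$ be a probability distribution on a measurable context space $\mathcal X$, let $\phi:[K]\times\mathcal X\to\mathcal Z\subseteq\mathbb R^d$ be a measurable feature map with $\mathbb E_{X\sim\mathcal G}\|\phi(a,X)\|_2^2<\infty$ for every $a$, and let $\Theta\subseteq\mathbb R^d$. Let $\mathcal P_K$ be the probability simplex. For measurable $p:\mathcal X\to\mathcal P_K$ write $\Sigma(p)=\mathbb E_{X\sim\mathcal G}\big[\sum_a p(a\mid X)\,\phi(a,X)\phi(a,X)^\top\big]$. Let $\lambda>0$ and let $e^*:\mathcal X\to\mathcal P_K$ be a measurable exploration policy such that $\Sigma(e^*)$ is invertible and $z^\top\Sigma(e^*)^{-1}z\le 1/\lambda$ for all $z\in\mathcal Z$. In round $t=1,\dots,T$ nature chooses $\theta_t\in\Theta$ as a function of the history $\mathcal F_{t-1}=\sigma\big(X_s,A_s,\ell_s(A_s,X_s):s<t\big)$; a context $X_t\sim\mathcal G$ independent of $\mathcal F_{t-1}$ is drawn; the losses are $\ell_t(a,x)=\langle\phi(a,x),\theta_t\rangle+\varepsilon_t(a)$ with $\mathbb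 E[\varepsilon_t(a)\mid X_t,\mathcal F_{t-1}]=0$; given $\mathcal F_{t-1}$, $X_t$ and $\varepsilon_t$, the arm $A_t$ is drawn from $\pi_t(\cdot\mid X_t)$; the decision-maker observes $\ell_t(A_t,X_t)$. Assume $|\langle z,\theta\rangle|\le 1$ for all $z\in\mathcal Z$, $\theta\in\Theta$, and $|\ell_t(a,x)|\le 1$ for all $t,a,x$. Algorithm (BoBW-RealFTRL). Let $H(q)=\sum_a q(a)\log(1/q(a))$ and $\psi=-H$. Put $$\frac1{\eta_1}=\sqrt{\frac{(1/\lambda+d)\log T}{\log K}},\qquad \frac1{\eta_{t+1}}=\frac1{\eta_t}+\frac1{\eta_1}\,\frac1{\sqrt{1+(\log K)^{-1}\sum_{s=1}^tH(q_s(X_s))}},\qquad \gamma_t=\frac{\eta_t}{\lambda},$$ $q_1(x)=(1/K,\dots,1/K)$ and, for $t\ge2$, $$q_t(x)\in\operatorname*{arg\,min}_{q\in\mathcal P_K}\Big\{\sum_{s=1}^{t-1}\sum_a q(a)\langle\widehat\theta_s,\phi(a,x)\rangle+\frac1{\eta_t}\psi(q)\Big\},$$ $$\pi_t(x)=(1-\gamma_t)q_t(x)+\gamma_te^*(x),\qquad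 \widehat\theta_t=\Sigma(\pi_t)^{-1}\phi(A_t,X_t)\,\ell_t(A_t,X_t).$$ Assume $\gamma_1\le1$ (hence all $\gamma_t\le 1$), so that every $\pi_t(x)$ is a probability vector. With $\rho$ ranging over the measurable maps $\mathcal X\to[K]$, define the regret $R_T=\sup_\rho\mathbb E\big[\sum_{t=1}^T\{\ell_t(A_t,X_t)-\ell_t(\rho(X_t),X_t)\}\big]$, let $\rho^*_T$ be a minimizer of $\rho\mapsto\mathbb E\big[\sum_{t=1}^T\langle\phi(\rho(X_t),X_t),\theta_t\rangle\big]$, and put $\overline Q(\rho)=\mathbb E\big[\sum_{t=1}^T\{1-q_t(\rho(X_0)\mid X_0)\}\big]$ with $X_0\sim\mathcal G$ independent of the interaction. Theorem. There is a universal constant $C>0$ such that in every such setting a minimizer $\rho^*_T$ exists, and for every minimizer $\rho^*_T$ $$R_T\le C\left(\eta_1\Big(\frac1\lambda+d\Big)\frac{\log T}{\sqrt{\log K}}+\frac1{\eta_1}\sqrt{\log K}\right)\sqrt{\log(KT)}\,\max\Big\{\overline Q^{1/2}(\rho^*_T),\,1\Big\}.$$ -/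

import Mathlib

open MeasureTheory ProbabilityTheory
open scoped Matrix

noncomputable section

namespace LinBandit

/-- The Shannon entropy `H(q) = ∑ₐ q(a) log (1 / q(a))` (with `0 log 0 = 0`). -/
def entropy {K : ℕ} (q : Fin K → ℝ) : ℝ := ∑ a, Real.negMulLog (q a)

/-- The regularizer `ψ = -H` (negative Shannon entropy). -/
def regularizer {K : ℕ} (q : Fin K → ℝ) : ℝ := -entropy q

/-- What the decision-maker knows in advance: the context distribution `G`, the feature map `φ`,
the exploration policy `e*`, its parameter `λ`, and the number `T` of rounds. -/
structure Setting (𝒳 : Type*) [MeasurableSpace 𝒳] (K d : ℕ) where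
  G : Measure 𝒳
  φ : Fin K → 𝒳 → Fin d → ℝ
  explo : 𝒳 → Fin K → ℝ
  lam : ℝ
  T : ℕ

/-- The state of the algorithm at the beginning of round `t`: the sum `∑_{s<t} θ̂_s` of the
past parameter estimates, the inverse learning rate `1 / η_t`, and the sum
`∑_{s<t} H(q_s(X_s))` of the past entropies. -/
structure State (d : ℕ) where
  cumEst : Fin d → ℝ
  invRate : ℝ
  cumEnt : ℝ

namespace Setting

variable {𝒳 : Type*} [MeasurableSpace 𝒳] {K d : ℕ} (S : Setting 𝒳 K d)

/-- `Σ(p) = 𝔼_{X₀ ∼ G, a ∼ p(X₀)} [φ(a, X₀) φ(a, X₀)ᵀ]`. -/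
def covariance (p : 𝒳 → Fin K → ℝ) : Matrix (Fin d) (Fin d) ℝ :=
  Matrix.of fun i j => ∫ x, ∑ a, p x a * (S.φ a x i * S.φ a x j) ∂S.G

/-- `1 / η₁ = √((1/λ + d) log T / log K)`. -/
def invRate₁ : ℝ := Real.sqrt ((1 / S.lam + d) * Real.log S.T / Real.log K)

/-- `η₁`. -/
def rate₁ : ℝ := 1 / S.invRate₁

/-- The FTRL objective at context `x`:
`q ↦ ∑_{s<t} ⟨ℓ̂_s(x), q⟩ + (1/η_t) ψ(q)`, where `ℓ̂_s(a, x) = ⟨θ̂_s, φ(a, x)⟩`. -/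
def objective (σ : State d) (x : 𝒳) (q : Fin K → ℝ) : ℝ :=
  ∑ a, (σ.cumEst ⬝ᵥ S.φ a x) * q a + σ.invRate * regularizer q

/-- `q_t(x)`: uniform in the first round, and a minimizer of the FTRL objective over the
probability simplex later. Rounds are numbered from `0`, so the first round is `t = 0`. -/
def q (t : ℕ) (σ : State d) (x : 𝒳) : Fin K → ℝ :=
  if t = 0 then fun _ => 1 / (K : ℝ)
  else Classical.epsilon fun p : Fin K → ℝ =>
    p ∈ stdSimplex ℝ (Fin K) ∧ IsMinOn (S.objective σ x) (stdSimplex ℝ (Fin K)) p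

/-- `γ_t = η_t / λ`. -/
def mixing (σ : State d) : ℝ := (1 / σ.invRate) / S.lam

/-- `π_t(x) = (1 - γ_t) q_t(x) + γ_t e*(x)`. -/
def policy (t : ℕ) (σ : State d) (x : 𝒳) (a : Fin K) : ℝ :=
  (1 - S.mixing σ) * S.q t σ x a + S.mixing σ * S.explo x a

/-- `θ̂_t = Σ_t⁻¹ φ(A_t, X_t) ℓ_t(A_t, X_t)`, where `Σ_t = Σ(π_t)`. The observation of a round is
the triple (context, chosen arm, loss of the chosen arm). -/
def estimate (t : ℕ) (σ : State d) (o : 𝒳 × Fin K × ℝ) : Fin d → ℝ :=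
  o.2.2 • ((S.covariance (S.policy t σ))⁻¹ *ᵥ S.φ o.2.1 o.1)

/-- The update at the end of round `t`; in particular
`1/η_{t+1} = 1/η_t + (1/η₁) / √(1 + (log K)⁻¹ ∑_{s≤t} H(q_s(X_s)))`. -/
def update (t : ℕ) (σ : State d) (o : 𝒳 × Fin K × ℝ) : State d where
  cumEst := σ.cumEst + S.estimate t σ o
  invRate := σ.invRate + S.invRate₁ *
    (1 / Real.sqrt (1 + (Real.log K)⁻¹ * (σ.cumEnt + entropy (S.q t σ o.1))))
  cumEnt := σ.cumEnt + entropy (S.q t σ o.1)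

/-- The state at the beginning of round `t`, given the sequence of observations. -/
def state (o : ℕ → 𝒳 × Fin K × ℝ) : ℕ → State d
  | 0 => ⟨0, S.invRate₁, 0⟩
  | t + 1 => S.update t (state o t) (o t)

/-- The assumptions on the contexts, the features and the exploration policy; `𝒵` is the feature
space. Square integrability of the features says that `Σ(p)` exists for every policy `p`. -/
structure Admissible (𝒵 : Set (Fin d → ℝ)) : Prop where
  prob : IsProbabilityMeasure S.G
  measurable_φ : ∀ a, Measurable (S.φ a)
  φ_mem : ∀ a x, S.φ a x ∈ 𝒵
  integrable_φ : ∀ a i, Integrable (fun x => S.φ a x i ^ 2) S.G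
  measurable_explo : Measurable S.explo
  explo_mem : ∀ x, S.explo x ∈ stdSimplex ℝ (Fin K)
  lam_pos : 0 < S.lam
  isUnit_cov : IsUnit (S.covariance S.explo)
  explo_bound : ∀ z ∈ 𝒵, z ⬝ᵥ ((S.covariance S.explo)⁻¹ *ᵥ z) ≤ 1 / S.lam

end Setting

/-- The random variables of the interaction: contexts `X_t`, parameters `θ_t`, noises `ε_t(a)` and
chosen arms `A_t`, in the rounds `t = 0, …, T - 1`. -/
structure Interaction (Ω 𝒳 : Type*) (K d : ℕ) where
  X : ℕ → Ω → 𝒳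
  θ : ℕ → Ω → Fin d → ℝ
  ε : ℕ → Ω → Fin K → ℝ
  A : ℕ → Ω → Fin K

namespace Interaction

variable {Ω 𝒳 : Type*} [MeasurableSpace Ω] [MeasurableSpace 𝒳] {K d : ℕ}
  (I : Interaction Ω 𝒳 K d) (S : Setting 𝒳 K d)

/-- The linear model `ℓ_t(a, x) = ⟨φ(a, x), θ_t⟩ + ε_t(a)`. -/
def loss (t : ℕ) (a : Fin K) (x : 𝒳) (ω : Ω) : ℝ := S.φ a x ⬝ᵥ I.θ t ω + I.ε t ω a

/-- The observation `(X_t, A_t, ℓ_t(A_t, X_t))` of round `t`. -/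
def obs (ω : Ω) (t : ℕ) : 𝒳 × Fin K × ℝ :=
  (I.X t ω, I.A t ω, I.loss S t (I.A t ω) (I.X t ω) ω)

/-- The σ-algebra generated by the observations of the rounds before `t`. -/
@[reducible] def history (t : ℕ) : MeasurableSpace Ω :=
  ⨆ s ∈ Finset.range t, MeasurableSpace.comap (fun ω => I.obs S ω s) inferInstance

/-- The random `q_t(x)` of the algorithm. -/
def q (t : ℕ) (ω : Ω) (x : 𝒳) : Fin K → ℝ := S.q t (S.state (I.obs S ω) t) x

/-- The random policy `π_t(x)` of the algorithm. -/
def policy (t : ℕ) (ω : Ω) (x : 𝒳) : Fin K → ℝ := S.policy t (S.state (I.obs S ω) t) x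

/-- The interaction of nature with the algorithm, with parameter space `Θ` and feature
space `𝒵`. -/
structure IsRun (μ : Measure Ω) (𝒵 Θ : Set (Fin d → ℝ)) : Prop where
  measurable_X : ∀ t < S.T, Measurable (I.X t)
  measurable_ε : ∀ t < S.T, Measurable (I.ε t)
  measurable_A : ∀ t < S.T, Measurable (I.A t)
  /-- Nature decides `θ_t` based on the history. -/
  measurable_θ : ∀ t < S.T, Measurable[I.history S t] (I.θ t)
  /-- The context `X_t` has law `G` and is independent of the past. -/
  law_X : ∀ t < S.T, μ.map (I.X t) = S.G
  indep_X : ∀ t < S.T, Indep (MeasurableSpace.comap (I.X t) inferInstance) (I.history S t) μ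
  /-- `𝔼[ε_t(a) | X_t, history] = 0`. -/
  noise : ∀ t < S.T, ∀ a,
    μ[fun ω => I.ε t ω a | I.history S t ⊔ MeasurableSpace.comap (I.X t) inferInstance] =ᵐ[μ] 0
  /-- Given the history, the context and the losses of the round, the arm `A_t` is drawn
  from `π_t(X_t)`. -/
  draw : ∀ t < S.T, ∀ a,
    μ[(I.A t ⁻¹' {a}).indicator (fun _ => (1 : ℝ)) |
        I.history S t ⊔ MeasurableSpace.comap (I.X t) inferInstance ⊔
          MeasurableSpace.comap (I.ε t) inferInstance]
      =ᵐ[μ] fun ω => I.policy S t ω (I.X t ω) a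
  θ_mem : ∀ t < S.T, ∀ᵐ ω ∂μ, I.θ t ω ∈ Θ
  linear_bound : ∀ z ∈ 𝒵, ∀ ϑ ∈ Θ, |z ⬝ᵥ ϑ| ≤ 1
  loss_bound : ∀ t < S.T, ∀ᵐ ω ∂μ, ∀ a x, |I.loss S t a x ω| ≤ 1

/-- The regret `R_T = sup_ρ 𝔼[∑_t (ℓ_t(A_t, X_t) - ℓ_t(ρ(X_t), X_t))]` over the
measurable maps `ρ` from contexts to arms. -/
def regret (μ : Measure Ω) : ℝ :=
  ⨆ ρ : {ρ : 𝒳 → Fin K // Measurable ρ},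
    ∫ ω, ∑ t ∈ Finset.range S.T,
      (I.loss S t (I.A t ω) (I.X t ω) ω - I.loss S t (ρ.1 (I.X t ω)) (I.X t ω) ω) ∂μ

/-- `ρ` minimizes `𝔼[∑_t ⟨φ(ρ(X_t), X_t), θ_t⟩]` over the measurable maps from contexts to
arms. -/
def IsOptimal (μ : Measure Ω) (ρ : 𝒳 → Fin K) : Prop :=
  Measurable ρ ∧ ∀ ρ' : 𝒳 → Fin K, Measurable ρ' →
    ∫ ω, ∑ t ∈ Finset.range S.T, S.φ (ρ (I.X t ω)) (I.X t ω) ⬝ᵥ I.θ t ω ∂μ ≤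
      ∫ ω, ∑ t ∈ Finset.range S.T, S.φ (ρ' (I.X t ω)) (I.X t ω) ⬝ᵥ I.θ t ω ∂μ

/-- `Q(ρ | x) = ∑_t (1 - q_t(ρ(x) | x))`. -/
def Q (ρ : 𝒳 → Fin K) (ω : Ω) (x : 𝒳) : ℝ :=
  ∑ t ∈ Finset.range S.T, (1 - I.q S t ω x (ρ x))

/-- `Q̄(ρ) = 𝔼[Q(ρ | X₀)]`, where `X₀ ∼ G` is independent of the interaction. -/
def Qbar (μ : Measure Ω) (ρ : 𝒳 → Fin K) : ℝ := ∫ ω, ∫ x, I.Q S ρ ω x ∂S.G ∂μ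

end Interaction

end LinBandit

end

/-! The regret is analysed one context at a time. The parameter `θ_t` and the state of the algorithm
depend on the history only, and `X_t` is independent of it. Hence the expected loss in a round, of
the learner or of a fixed comparator, is an integral over `μ.prod S.G`, with a fresh context in
place of `X_t` (`map_context`, `integral_regret`). For each fixed context x the FTRL distributions
are exponential weights run on the estimated losses ℓ̂_t(a) = ⟨θ̂_t, φ(a, x)⟩, and unbiasedness
(`integral_est`) exchanges true losses for estimated ones. A minimizer ρ* has the least expected
loss among comparators, so a bound against ρ* bounds the supremum.

For almost every outcome and all x, the minimum of the entropic objective is the potential -β log Z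
with β = 1/η. Telescoping it (`ftrl_regret`) bounds the regret on estimated losses by (1/η_1) log K
+ Σ (1/η_{t+1} - 1/η_t) H(q_{t+1}) + Σ η_t Σ_a q_t(a) ℓ̂_t(a)². This requires |ℓ̂_t| ≤ 1/η_t, which
is what γ_t = η_t/λ provides. Since E ℓ̂_t(a)² is at most the mean of φᵀΣ(π_t)⁻¹φ, the identity
tr(Σ⁻¹Σ) = d turns the last sum into O(1/λ + d) Σ E η_t (`integral_stability_le`). Exploration costs
a further 2γ_t = 2η_t/λ per round.

Let W = Σ H(q_t(X_t)). The adaptive rate makes the entropy penalty O((1/η_1) √(log K) √W) and Σ η_t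
= O(η_1 (1 + log T) √W / √(log K)) on every path (`sum_rate_mul_le`, `sum_inv_rate_le`). The penalty
bound uses the realized contexts, so the fresh context is exchanged back for `X_t`
(`integral_entropy_context`).

Finally H(q) ≤ (1 - q(a))(1 + log(KT)) + 1/T for any arm a. Taking a = ρ*(x) gives E W ≤ (1 +
log(KT)) Q̄(ρ*) + 1, and concavity of the square root finishes the proof. -/

noncomputable section

namespace LinBandit

/-! ### Semidefinite quadratic forms and their inverses -/

section LinearAlgebra

variable {d : ℕ} {M N : Matrix (Fin d) (Fin d) ℝ}

lemma dotProduct_mulVec_symm (hM : M.IsSymm) (u v : Fin d → ℝ) :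
    u ⬝ᵥ (M *ᵥ v) = v ⬝ᵥ (M *ᵥ u) := by
  rw [Matrix.dotProduct_mulVec, ← Matrix.mulVec_transpose, hM.eq, dotProduct_comm]

/-- Cauchy–Schwarz for a semidefinite form: the form at u + t v is a nonnegative quadratic in t, so
its discriminant is not positive. -/
lemma sq_dotProduct_mulVec_le (hM : M.IsSymm) (hpos : ∀ u, 0 ≤ u ⬝ᵥ (M *ᵥ u))
    (u v : Fin d → ℝ) :
    (u ⬝ᵥ (M *ᵥ v)) ^ 2 ≤ (u ⬝ᵥ (M *ᵥ u)) * (v ⬝ᵥ (M *ᵥ v)) := by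
  have key : ∀ t : ℝ, 0 ≤ (v ⬝ᵥ (M *ᵥ v)) * (t * t) + (2 * (u ⬝ᵥ (M *ᵥ v))) * t
      + u ⬝ᵥ (M *ᵥ u) := fun t => by
    have h := hpos (u + t • v)
    simp only [Matrix.mulVec_add, Matrix.mulVec_smul, dotProduct_add, add_dotProduct,
      smul_dotProduct, dotProduct_smul, smul_eq_mul] at h
    rw [dotProduct_mulVec_symm hM v u] at h
    linarith
  have := discrim_le_zero key
  unfold discrim at this
  nlinarith

lemma mulVec_eq_zero_of_form_eq_zero (hM : M.IsSymm) (hpos : ∀ u, 0 ≤ u ⬝ᵥ (M *ᵥ u))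
    {v : Fin d → ℝ} (hv : v ⬝ᵥ (M *ᵥ v) ≤ 0) : M *ᵥ v = 0 := by
  have h := sq_dotProduct_mulVec_le hM hpos (M *ᵥ v) v
  have h0 : v ⬝ᵥ (M *ᵥ v) = 0 := le_antisymm hv (hpos v)
  rw [h0, mul_zero] at h
  have h1 : (M *ᵥ v) ⬝ᵥ (M *ᵥ v) = 0 := by nlinarith
  exact dotProduct_self_eq_zero.mp h1

/-- A positive semidefinite form that dominates a multiple of a definite one is invertible. -/
lemma isUnit_of_form_le (hN : N.IsSymm) (hNpos : ∀ u, 0 ≤ u ⬝ᵥ (N *ᵥ u)) (hNu : IsUnit N) {c : ℝ} (hc : 0 < c)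
    (hle : ∀ u, c * (u ⬝ᵥ (N *ᵥ u)) ≤ u ⬝ᵥ (M *ᵥ u)) : IsUnit M := by
  rw [← Matrix.mulVec_injective_iff_isUnit]
  intro u v huv
  have h0 : M *ᵥ (u - v) = 0 := by rw [Matrix.mulVec_sub, sub_eq_zero]; exact huv
  have h1 := hle (u - v)
  rw [h0, dotProduct_zero] at h1
  have h2 : (u - v) ⬝ᵥ (N *ᵥ (u - v)) ≤ 0 := by
    by_contra h
    push Not at h
    nlinarith [mul_pos hc h]
  have h3 := mulVec_eq_zero_of_form_eq_zero hN hNpos h2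
  have h4 := (Matrix.mulVec_injective_iff_isUnit.mpr hNu) (h3.trans (Matrix.mulVec_zero N).symm)
  exact sub_eq_zero.mp h4

lemma mulVec_inv_mulVec (hM : IsUnit M) (z : Fin d → ℝ) : M *ᵥ (M⁻¹ *ᵥ z) = z := by
  rw [Matrix.mulVec_mulVec, Matrix.mul_nonsing_inv _ ((Matrix.isUnit_iff_isUnit_det _).mp hM),
    Matrix.one_mulVec]

lemma inv_isSymm (hM : M.IsSymm) : (M⁻¹).IsSymm := by
  rw [Matrix.IsSymm, Matrix.transpose_nonsing_inv, hM.eq]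

lemma inv_form_nonneg (hM : IsUnit M) (hMpos : ∀ u, 0 ≤ u ⬝ᵥ (M *ᵥ u)) (z : Fin d → ℝ) :
    0 ≤ z ⬝ᵥ (M⁻¹ *ᵥ z) := by
  have := hMpos (M⁻¹ *ᵥ z)
  rwa [mulVec_inv_mulVec hM, dotProduct_comm] at this

/-- Inversion reverses the order of forms. With u = M⁻¹z, Cauchy–Schwarz for N gives (z·u)² ≤
(uᵀNu)(zᵀN⁻¹z), and c uᵀNu ≤ uᵀMu = z·u; one factor z·u cancels. -/
lemma inv_form_le (hMu : IsUnit M)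
    (hMpos : ∀ u, 0 ≤ u ⬝ᵥ (M *ᵥ u))
    (hN : N.IsSymm) (hNpos : ∀ u, 0 ≤ u ⬝ᵥ (N *ᵥ u)) (hNu : IsUnit N) {c : ℝ} (hc : 0 < c)
    (hle : ∀ u, c * (u ⬝ᵥ (N *ᵥ u)) ≤ u ⬝ᵥ (M *ᵥ u)) (z : Fin d → ℝ) :
    z ⬝ᵥ (M⁻¹ *ᵥ z) ≤ (z ⬝ᵥ (N⁻¹ *ᵥ z)) / c := by
  set u := M⁻¹ *ᵥ z with hu
  have hs : u ⬝ᵥ (M *ᵥ u) = z ⬝ᵥ u := by rw [hu, mulVec_inv_mulVec hMu, dotProduct_comm]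
  have h1 := sq_dotProduct_mulVec_le hN hNpos u (N⁻¹ *ᵥ z)
  rw [mulVec_inv_mulVec hNu, dotProduct_comm u z, dotProduct_comm (N⁻¹ *ᵥ z) z] at h1
  have h2 := hle u
  rw [hs] at h2
  have h3 := hMpos u
  rw [hs] at h3
  have h4 := inv_form_nonneg hNu hNpos z
  rw [le_div_iff₀ hc]
  rcases h3.eq_or_lt with h | h
  · rw [← h, zero_mul]; exact h4
  · have : (z ⬝ᵥ u) * (z ⬝ᵥ u * c) ≤ (z ⬝ᵥ u) * (z ⬝ᵥ (N⁻¹ *ᵥ z)) := by nlinarith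
    exact le_of_mul_le_mul_left this h

lemma abs_inv_form_le (hM : M.IsSymm) (hMu : IsUnit M) (hMpos : ∀ u, 0 ≤ u ⬝ᵥ (M *ᵥ u))
    {y z : Fin d → ℝ} {b : ℝ} (hb : 0 ≤ b) (hy : y ⬝ᵥ (M⁻¹ *ᵥ y) ≤ b)
    (hz : z ⬝ᵥ (M⁻¹ *ᵥ z) ≤ b) : |y ⬝ᵥ (M⁻¹ *ᵥ z)| ≤ b := by
  have h := sq_dotProduct_mulVec_le (inv_isSymm hM) (inv_form_nonneg hMu hMpos) y z
  have h1 := inv_form_nonneg hMu hMpos y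
  have h2 := inv_form_nonneg hMu hMpos z
  apply abs_le_of_sq_le_sq _ hb
  nlinarith [mul_le_mul hy hz h2 hb]

end LinearAlgebra

/-! ### The covariance of a policy -/

section Covariance

variable {𝒳 : Type*} [MeasurableSpace 𝒳] {K d : ℕ} {S : Setting 𝒳 K d} {𝒵 : Set (Fin d → ℝ)}

/-- A measurable map from contexts to the probability simplex. -/
structure IsPolicy (p : 𝒳 → Fin K → ℝ) : Prop where
  measurable : Measurable p
  mem : ∀ x, p x ∈ stdSimplex ℝ (Fin K)

lemma IsPolicy.nonneg {p : 𝒳 → Fin K → ℝ} (hp : IsPolicy p) (x : 𝒳) (a : Fin K) : 0 ≤ p x a :=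
  (hp.mem x).1 a

lemma le_one_of_mem_stdSimplex {p : Fin K → ℝ} (hp : p ∈ stdSimplex ℝ (Fin K)) (a : Fin K) :
    p a ≤ 1 := by
  rw [← hp.2]
  exact Finset.single_le_sum (fun b _ => hp.1 b) (Finset.mem_univ a)

namespace Setting.Admissible

variable (hS : S.Admissible 𝒵)
include hS

lemma isPolicy_explo : IsPolicy S.explo := ⟨hS.measurable_explo, hS.explo_mem⟩

lemma integrable_mul (a : Fin K) (i j : Fin d) :
    Integrable (fun x => S.φ a x i * S.φ a x j) S.G := by
  have hm : ∀ i, Measurable fun x => S.φ a x i := fun i =>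
    (measurable_pi_apply i).comp (hS.measurable_φ a)
  refine ((hS.integrable_φ a i).add (hS.integrable_φ a j)).mono'
    ((hm i).mul (hm j)).aestronglyMeasurable (.of_forall fun x => ?_)
  simp only [Real.norm_eq_abs, Pi.add_apply, abs_mul]
  nlinarith [sq_nonneg (|S.φ a x i| - |S.φ a x j|), sq_abs (S.φ a x i), sq_abs (S.φ a x j),
    abs_nonneg (S.φ a x i), abs_nonneg (S.φ a x j)]

omit hS in
lemma _root_.LinBandit.integrable_policy_mul {p : 𝒳 → Fin K → ℝ} (hp : IsPolicy p) {f : 𝒳 → ℝ}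
    (hf : Integrable f S.G) (a : Fin K) : Integrable (fun x => p x a * f x) S.G := by
  refine hf.bdd_mul (c := 1) ((measurable_pi_apply a).comp hp.measurable).aestronglyMeasurable
    (.of_forall fun x => ?_)
  rw [Real.norm_eq_abs, abs_of_nonneg (hp.nonneg x a)]
  exact le_one_of_mem_stdSimplex (hp.mem x) a

/-- Pairing with an arbitrary matrix B serves two purposes: B = u vᵀ gives the quadratic form of the
covariance, and B = Σ⁻¹ gives the trace identity. -/
lemma integral_form {p : 𝒳 → Fin K → ℝ} (hp : IsPolicy p) (B : Fin d → Fin d → ℝ) :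
    ∑ i, ∑ j, B i j * S.covariance p i j =
      ∫ x, ∑ a, p x a * ∑ i, ∑ j, B i j * (S.φ a x i * S.φ a x j) ∂S.G := by
  have hint : ∀ i j, Integrable (fun x => ∑ a, p x a * (S.φ a x i * S.φ a x j)) S.G :=
    fun i j => integrable_finsetSum _ fun a _ =>
      integrable_policy_mul hp (hS.integrable_mul a i j) a
  simp only [Setting.covariance, Matrix.of_apply, ← integral_const_mul]
  rw [show (∑ i, ∑ j, ∫ x, B i j * ∑ a, p x a * (S.φ a x i * S.φ a x j) ∂S.G) =
    ∑ i, ∫ x, ∑ j, B i j * ∑ a, p x a * (S.φ a x i * S.φ a x j) ∂S.G from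
    Finset.sum_congr rfl fun i _ => (integral_finsetSum _ fun j _ => (hint i j).const_mul _).symm,
    ← integral_finsetSum _ fun i _ => integrable_finsetSum _ fun j _ => (hint i j).const_mul _]
  congr 1 with x
  simp only [Finset.mul_sum]
  symm
  rw [Finset.sum_comm]
  refine Finset.sum_congr rfl fun j _ => ?_
  rw [Finset.sum_comm]
  refine Finset.sum_congr rfl fun i _ => Finset.sum_congr rfl fun a _ => by ring

lemma dotProduct_covariance {p : 𝒳 → Fin K → ℝ} (hp : IsPolicy p) (u v : Fin d → ℝ) :
    u ⬝ᵥ (S.covariance p *ᵥ v) =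
      ∫ x, ∑ a, p x a * ((S.φ a x ⬝ᵥ u) * (S.φ a x ⬝ᵥ v)) ∂S.G := by
  have h := hS.integral_form hp fun i j => u i * v j
  convert h using 1
  · simp only [dotProduct, Matrix.mulVec, Finset.mul_sum]
    exact Finset.sum_congr rfl fun i _ => Finset.sum_congr rfl fun j _ => by ring
  · congr 1 with x
    refine Finset.sum_congr rfl fun a _ => ?_
    simp only [dotProduct, Finset.sum_mul_sum]
    congr 1
    exact Finset.sum_congr rfl fun i _ => Finset.sum_congr rfl fun j _ => by ring

omit hS in
lemma _root_.LinBandit.covariance_isSymm (p : 𝒳 → Fin K → ℝ) : (S.covariance p).IsSymm := by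
  ext i j
  simp only [Setting.covariance, Matrix.transpose_apply, Matrix.of_apply]
  congr 1 with x
  exact Finset.sum_congr rfl fun a _ => by ring

lemma covariance_form_nonneg {p : 𝒳 → Fin K → ℝ} (hp : IsPolicy p) (u : Fin d → ℝ) :
    0 ≤ u ⬝ᵥ (S.covariance p *ᵥ u) := by
  rw [hS.dotProduct_covariance hp]
  exact integral_nonneg fun x => Finset.sum_nonneg fun a _ =>
    mul_nonneg (hp.nonneg x a) (mul_self_nonneg _)

lemma integrable_form {p : 𝒳 → Fin K → ℝ} (hp : IsPolicy p) (u v : Fin d → ℝ) :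
    Integrable (fun x => ∑ a, p x a * ((S.φ a x ⬝ᵥ u) * (S.φ a x ⬝ᵥ v))) S.G := by
  refine integrable_finsetSum _ fun a _ => integrable_policy_mul hp ?_ a
  simp only [dotProduct, Finset.sum_mul_sum]
  refine integrable_finsetSum _ fun i _ => integrable_finsetSum _ fun j _ => ?_
  refine ((hS.integrable_mul a i j).const_mul (u i * v j)).congr (.of_forall fun x => ?_)
  simp only
  ring

lemma covariance_form_mono {p r : 𝒳 → Fin K → ℝ} (hp : IsPolicy p) (hr : IsPolicy r) {c : ℝ}
    (h : ∀ x a, c * r x a ≤ p x a) (u : Fin d → ℝ) :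
    c * (u ⬝ᵥ (S.covariance r *ᵥ u)) ≤ u ⬝ᵥ (S.covariance p *ᵥ u) := by
  rw [hS.dotProduct_covariance hp, hS.dotProduct_covariance hr, ← integral_const_mul]
  refine integral_mono ((hS.integrable_form hr u u).const_mul c) (hS.integrable_form hp u u)
    fun x => ?_
  simp only [Finset.mul_sum]
  refine Finset.sum_le_sum fun a _ => ?_
  rw [← mul_assoc]
  exact mul_le_mul_of_nonneg_right (h x a) (mul_self_nonneg _)

/-- Exploration with weight `c` makes the covariance invertible. -/
lemma isUnit_covariance {p : 𝒳 → Fin K → ℝ} (hp : IsPolicy p) {c : ℝ} (hc : 0 < c)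
    (h : ∀ x a, c * S.explo x a ≤ p x a) : IsUnit (S.covariance p) :=
  isUnit_of_form_le (covariance_isSymm S.explo) (hS.covariance_form_nonneg hS.isPolicy_explo) hS.isUnit_cov hc
    (hS.covariance_form_mono hp hS.isPolicy_explo h)

lemma inv_covariance_form_le {p : 𝒳 → Fin K → ℝ} (hp : IsPolicy p) {c : ℝ} (hc : 0 < c)
    (h : ∀ x a, c * S.explo x a ≤ p x a) {z : Fin d → ℝ} (hz : z ∈ 𝒵) :
    z ⬝ᵥ ((S.covariance p)⁻¹ *ᵥ z) ≤ 1 / S.lam / c :=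
  (inv_form_le (hS.isUnit_covariance hp hc h) (hS.covariance_form_nonneg hp)
    (covariance_isSymm S.explo) (hS.covariance_form_nonneg hS.isPolicy_explo) hS.isUnit_cov hc
    (hS.covariance_form_mono hp hS.isPolicy_explo h) z).trans
    (div_le_div_of_nonneg_right (hS.explo_bound z hz) hc.le)

lemma abs_inv_covariance_form_le {p : 𝒳 → Fin K → ℝ} (hp : IsPolicy p) {c : ℝ} (hc : 0 < c)
    (h : ∀ x a, c * S.explo x a ≤ p x a) {y z : Fin d → ℝ} (hy : y ∈ 𝒵) (hz : z ∈ 𝒵) :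
    |y ⬝ᵥ ((S.covariance p)⁻¹ *ᵥ z)| ≤ 1 / S.lam / c :=
  abs_inv_form_le (covariance_isSymm p) (hS.isUnit_covariance hp hc h)
    (hS.covariance_form_nonneg hp)
    (div_nonneg (one_div_nonneg.mpr hS.lam_pos.le) hc.le)
    (hS.inv_covariance_form_le hp hc h hy) (hS.inv_covariance_form_le hp hc h hz)

/-- This is tr(Σ⁻¹Σ) = d, the source of the dimension in the regret bound. -/
lemma integral_inv_covariance_form {p : 𝒳 → Fin K → ℝ} (hp : IsPolicy p)
    (hu : IsUnit (S.covariance p)) :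
    ∫ x, ∑ a, p x a * (S.φ a x ⬝ᵥ ((S.covariance p)⁻¹ *ᵥ S.φ a x)) ∂S.G = d := by
  have h := hS.integral_form hp fun i j => (S.covariance p)⁻¹ i j
  have h1 : ∑ i, ∑ j, (S.covariance p)⁻¹ i j * S.covariance p i j = d := by
    have : ((S.covariance p)⁻¹ * S.covariance p).trace = d := by
      rw [Matrix.nonsing_inv_mul _ ((Matrix.isUnit_iff_isUnit_det _).mp hu), Matrix.trace_one,
        Fintype.card_fin]
    rw [← this]
    simp only [Matrix.trace, Matrix.diag, Matrix.mul_apply]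
    refine Finset.sum_congr rfl fun i _ => Finset.sum_congr rfl fun j _ => ?_
    rw [(covariance_isSymm (S := S) p).apply j i]
  rw [← h1, h]
  congr 1 with x
  refine Finset.sum_congr rfl fun a _ => ?_
  simp only [dotProduct, Matrix.mulVec, Finset.mul_sum]
  exact Finset.sum_congr rfl fun i _ => Finset.sum_congr rfl fun j _ => by ring

end Setting.Admissible

end Covariance

/-! ### Entropy against the mass off one arm -/

section Entropy

variable {K : ℕ}

lemma negMulLog_le_one_sub {p : ℝ} (hp : 0 ≤ p) (hp1 : p ≤ 1) : Real.negMulLog p ≤ 1 - p := by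
  rcases hp.eq_or_lt with rfl | h
  · simp
  · have := Real.one_sub_inv_le_log_of_pos h
    have h2 : p * (1 - p⁻¹) ≤ p * Real.log p := mul_le_mul_of_nonneg_left this hp
    rw [mul_sub, mul_inv_cancel₀ h.ne'] at h2
    rw [Real.negMulLog]
    linarith

/-- Write -p log p = p log N - p log(pN) and use log y ≥ 1 - 1/y at y = pN. -/
lemma negMulLog_le_mul_log_add {p N : ℝ} (hp : 0 ≤ p) (hN : 0 < N) :
    Real.negMulLog p ≤ p * Real.log N + 1 / N := by
  rcases hp.eq_or_lt with rfl | h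
  · simp [hN.le]
  · have := Real.one_sub_inv_le_log_of_pos (mul_pos h hN)
    rw [Real.log_mul h.ne' hN.ne'] at this
    have h2 := mul_le_mul_of_nonneg_left this hp
    have h3 : p * (p * N)⁻¹ = 1 / N := by field_simp
    rw [mul_sub, h3] at h2
    rw [Real.negMulLog]
    linarith

lemma entropy_nonneg {p : Fin K → ℝ} (hp : p ∈ stdSimplex ℝ (Fin K)) : 0 ≤ entropy p :=
  Finset.sum_nonneg fun a _ => Real.negMulLog_nonneg (hp.1 a) (le_one_of_mem_stdSimplex hp a)

/-- The entropy is controlled by the mass that is not on a given arm. -/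
lemma entropy_le_one_sub_mul {p : Fin K → ℝ} (hp : p ∈ stdSimplex ℝ (Fin K)) (a : Fin K) {T : ℝ}
    (hT : 0 < T) :
    entropy p ≤ (1 - p a) * (1 + Real.log (K * T)) + 1 / T := by
  have hK : (0 : ℝ) < K := by exact_mod_cast a.pos
  have hN : 0 < K * T := mul_pos hK hT
  have hsum : ∑ b ∈ Finset.univ.erase a, p b = 1 - p a := by
    rw [← hp.2, ← Finset.add_sum_erase _ _ (Finset.mem_univ a)]; ring
  rw [entropy, ← Finset.add_sum_erase _ _ (Finset.mem_univ a)]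
  -- The scale N = KT is chosen so that at most K error terms 1/N add up to 1/T, hence to 1 over all
  -- rounds.
  have h1 : ∑ b ∈ Finset.univ.erase a, Real.negMulLog (p b) ≤
      ∑ b ∈ Finset.univ.erase a, (p b * Real.log (K * T)) + K * (1 / (K * T)) := by
    calc _ ≤ ∑ b ∈ Finset.univ.erase a, (p b * Real.log (K * T) + 1 / (K * T)) :=
          Finset.sum_le_sum fun b _ => negMulLog_le_mul_log_add (hp.1 b) hN
      _ ≤ _ := by
          rw [Finset.sum_add_distrib, Finset.sum_const, nsmul_eq_mul]
          gcongr
          exact_mod_cast (Finset.card_le_univ _).trans_eq (Fintype.card_fin K)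
  rw [← Finset.sum_mul, hsum] at h1
  have h2 := negMulLog_le_one_sub (hp.1 a) (le_one_of_mem_stdSimplex hp a)
  have h3 : K * (1 / (K * T)) = 1 / T := by field_simp
  linarith

end Entropy

/-! ### Exponential weights: Gibbs distributions, their potential, and FTRL regret -/

section Gibbs

variable {K : ℕ}

/-- The partition function of the Gibbs distribution. -/
def partition (L : Fin K → ℝ) (β : ℝ) : ℝ := ∑ a, Real.exp (-(L a / β))

/-- The Gibbs distribution at temperature `β`. -/
def gibbs (L : Fin K → ℝ) (β : ℝ) (a : Fin K) : ℝ := Real.exp (-(L a / β)) / partition L β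

/-- The minimum over the simplex of the entropic objective. -/
def potential (L : Fin K → ℝ) (β : ℝ) : ℝ := -(β * Real.log (partition L β))

variable [NeZero K] (L : Fin K → ℝ) {β : ℝ}

lemma partition_pos (β : ℝ) : 0 < partition L β :=
  Finset.sum_pos (fun _ _ => Real.exp_pos _) Finset.univ_nonempty

lemma gibbs_pos (β : ℝ) (a : Fin K) : 0 < gibbs L β a := div_pos (Real.exp_pos _) (partition_pos L β)

lemma gibbs_mem (β : ℝ) : gibbs L β ∈ stdSimplex ℝ (Fin K) :=
  ⟨fun a => (gibbs_pos L β a).le, by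
    simp only [gibbs]
    rw [← Finset.sum_div]
    exact div_self (partition_pos L β).ne'⟩

lemma log_gibbs (β : ℝ) (a : Fin K) :
    Real.log (gibbs L β a) = -(L a / β) - Real.log (partition L β) := by
  rw [gibbs, Real.log_div (Real.exp_pos _).ne' (partition_pos L β).ne', Real.log_exp]

/-- The excess over the minimum is β times the relative entropy of p with respect to the Gibbs
distribution. The linear terms in `klFun` cancel because both vectors have total mass one.
Minimality and uniqueness of the Gibbs distribution both follow from this identity. -/
lemma objective_eq_kl (hβ : 0 < β) {p : Fin K → ℝ} (hp : p ∈ stdSimplex ℝ (Fin K)) :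
    ∑ a, L a * p a + β * regularizer p =
      β * ∑ a, gibbs L β a * InformationTheory.klFun (p a / gibbs L β a) + potential L β := by
  have h : ∀ a, gibbs L β a * InformationTheory.klFun (p a / gibbs L β a) =
      -Real.negMulLog (p a) + p a * (L a / β) + p a * Real.log (partition L β)
        + gibbs L β a - p a := by
    intro a
    have hg := gibbs_pos L β a
    rw [InformationTheory.klFun]
    rcases eq_or_ne (p a) 0 with h0 | h0
    · simp [h0]
    · rw [Real.log_div h0 hg.ne', log_gibbs, Real.negMulLog]
      field_simp
      ring
  simp only [h, regularizer, entropy, potential, Finset.sum_add_distrib, Finset.sum_sub_distrib,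
    Finset.sum_neg_distrib, ← Finset.sum_mul, hp.2, (gibbs_mem L β).2]
  have h2 : ∑ a, p a * (L a / β) = (∑ a, L a * p a) / β := by
    rw [Finset.sum_div]
    exact Finset.sum_congr rfl fun a _ => by ring
  rw [h2]
  field_simp
  ring

lemma potential_le_objective (hβ : 0 < β) {p : Fin K → ℝ} (hp : p ∈ stdSimplex ℝ (Fin K)) :
    potential L β ≤ ∑ a, L a * p a + β * regularizer p := by
  rw [objective_eq_kl L hβ hp]
  have : 0 ≤ ∑ a, gibbs L β a * InformationTheory.klFun (p a / gibbs L β a) :=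
    Finset.sum_nonneg fun a _ => mul_nonneg (gibbs_pos L β a).le
      (InformationTheory.klFun_nonneg (div_nonneg (hp.1 a) (gibbs_pos L β a).le))
  linarith [mul_nonneg hβ.le this]

lemma objective_gibbs (hβ : 0 < β) :
    ∑ a, L a * gibbs L β a + β * regularizer (gibbs L β) = potential L β := by
  rw [objective_eq_kl L hβ (gibbs_mem L β)]
  simp [(gibbs_pos L β _).ne', div_self, InformationTheory.klFun_one]

/-- Uniqueness matters because the algorithm may use any minimizer: the relative entropy vanishes
only at the Gibbs distribution. -/
lemma eq_gibbs_of_objective_le (hβ : 0 < β) {p : Fin K → ℝ} (hp : p ∈ stdSimplex ℝ (Fin K))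
    (h : ∑ a, L a * p a + β * regularizer p ≤ potential L β) : p = gibbs L β := by
  rw [objective_eq_kl L hβ hp] at h
  have hnn : ∀ a, 0 ≤ gibbs L β a * InformationTheory.klFun (p a / gibbs L β a) := fun a =>
    mul_nonneg (gibbs_pos L β a).le
      (InformationTheory.klFun_nonneg (div_nonneg (hp.1 a) (gibbs_pos L β a).le))
  have h0 : ∑ a, gibbs L β a * InformationTheory.klFun (p a / gibbs L β a) = 0 := by
    refine le_antisymm ?_ (Finset.sum_nonneg fun a _ => hnn a)
    by_contra h'
    push Not at h'
    linarith [mul_pos hβ h']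
  rw [Finset.sum_eq_zero_iff_of_nonneg fun a _ => hnn a] at h0
  funext a
  have h1 := (mul_eq_zero.mp (h0 a (Finset.mem_univ a))).resolve_left (gibbs_pos L β a).ne'
  rw [InformationTheory.klFun_eq_zero_iff (div_nonneg (hp.1 a) (gibbs_pos L β a).le)] at h1
  exact (div_eq_one_iff_eq (gibbs_pos L β a).ne').mp h1

omit [NeZero K] in
lemma partition_zero (β : ℝ) : partition (0 : Fin K → ℝ) β = K := by
  simp [partition]

omit [NeZero K] in
lemma potential_zero (β : ℝ) : potential (0 : Fin K → ℝ) β = -(β * Real.log K) := by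
  rw [potential, partition_zero]

omit [NeZero K] in
lemma gibbs_zero (β : ℝ) : gibbs (0 : Fin K → ℝ) β = fun _ => 1 / (K : ℝ) := by
  funext a
  rw [gibbs, partition_zero]
  simp

lemma entropy_le_log {p : Fin K → ℝ} (hp : p ∈ stdSimplex ℝ (Fin K)) :
    entropy p ≤ Real.log K := by
  have h := potential_le_objective (0 : Fin K → ℝ) one_pos hp
  rw [potential_zero] at h
  simp [regularizer] at h
  exact h

omit [NeZero K] in
lemma entropy_uniform : entropy (fun _ : Fin K => 1 / (K : ℝ)) = Real.log K := by
  rcases Nat.eq_zero_or_pos K with rfl | hK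
  · simp [entropy]
  have : (K : ℝ) ≠ 0 := by positivity
  simp only [entropy, Finset.sum_const, Finset.card_univ, Fintype.card_fin, nsmul_eq_mul,
    Real.negMulLog, one_div, Real.log_inv]
  field_simp

/-- The partition function is at least its summand at a. This is how the comparator enters the
regret bound. -/
lemma potential_le_apply (hβ : 0 < β) (a : Fin K) : potential L β ≤ L a := by
  have h : Real.exp (-(L a / β)) ≤ partition L β :=
    Finset.single_le_sum (f := fun b => Real.exp (-(L b / β))) (fun b _ => (Real.exp_pos _).le)
      (Finset.mem_univ a)
  have h1 := (Real.le_log_iff_exp_le (partition_pos L β)).mpr h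
  have h2 := mul_le_mul_of_nonneg_left h1 hβ.le
  have h3 : β * -(L a / β) = -L a := by field_simp
  rw [potential]
  linarith

/-- The stability estimate for exponential weights. -/
lemma potential_add_ge (hβ : 0 < β) {ℓ : Fin K → ℝ} (hℓ : ∀ a, |ℓ a| ≤ β) :
    potential L β + ∑ a, gibbs L β a * ℓ a - 1 / β * ∑ a, gibbs L β a * ℓ a ^ 2 ≤
      potential (L + ℓ) β := by
  have hZ := partition_pos L β
  -- The ratio of the partition functions is the Gibbs mean of exp(-ℓ/β), and exp(-y) ≤ 1 - y + y²
  -- for |y| ≤ 1; this is where |ℓ| ≤ β enters. The logarithm is then taken by 1 + y ≤ exp y.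
  have h1 : partition (L + ℓ) β ≤ partition L β *
      (1 - (∑ a, gibbs L β a * ℓ a) / β + (∑ a, gibbs L β a * ℓ a ^ 2) / β ^ 2) := by
    have he : partition (L + ℓ) β = partition L β * ∑ a, gibbs L β a * Real.exp (-(ℓ a / β)) := by
      rw [partition, Finset.mul_sum]
      refine Finset.sum_congr rfl fun a _ => ?_
      rw [gibbs, ← mul_assoc, mul_div_cancel₀ _ hZ.ne', ← Real.exp_add, Pi.add_apply]
      congr 1
      ring
    rw [he]
    refine mul_le_mul_of_nonneg_left ?_ hZ.le
    calc ∑ a, gibbs L β a * Real.exp (-(ℓ a / β))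
        ≤ ∑ a, gibbs L β a * (1 - ℓ a / β + ℓ a ^ 2 / β ^ 2) := by
          refine Finset.sum_le_sum fun a _ =>
            mul_le_mul_of_nonneg_left ?_ (gibbs_pos L β a).le
          have hb : |(-(ℓ a / β))| ≤ 1 := by
            rw [abs_neg, abs_div, abs_of_pos hβ]
            exact (div_le_one hβ).mpr (hℓ a)
          have := (abs_le.mp (Real.abs_exp_sub_one_sub_id_le hb)).2
          rw [neg_sq, div_pow] at this
          linarith
      _ = _ := by
          simp only [mul_add, mul_sub, mul_one, Finset.sum_add_distrib, Finset.sum_sub_distrib,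
            (gibbs_mem L β).2, Finset.sum_div, mul_div_assoc]
  have h2 : Real.log (partition (L + ℓ) β) ≤ Real.log (partition L β) +
      (-(∑ a, gibbs L β a * ℓ a) / β + (∑ a, gibbs L β a * ℓ a ^ 2) / β ^ 2) := by
    rw [Real.log_le_iff_le_exp (partition_pos _ β), Real.exp_add, Real.exp_log hZ]
    refine h1.trans (mul_le_mul_of_nonneg_left ?_ hZ.le)
    refine le_trans (le_of_eq ?_) (Real.add_one_le_exp _)
    ring
  have h3 := mul_le_mul_of_nonneg_left h2 hβ.le
  have h4 : β * (Real.log (partition L β) +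
      (-(∑ a, gibbs L β a * ℓ a) / β + (∑ a, gibbs L β a * ℓ a ^ 2) / β ^ 2)) =
      β * Real.log (partition L β) - ∑ a, gibbs L β a * ℓ a
        + 1 / β * ∑ a, gibbs L β a * ℓ a ^ 2 := by
    field_simp
    ring
  rw [potential, potential]
  linarith

/-- The Gibbs distribution at β' competes in the minimization at β, and its two objective values
differ by (β' - β) times its entropy. -/
lemma potential_rate_ge {β' : ℝ} (hβ : 0 < β) (hβ' : 0 < β') :
    potential L β - (β' - β) * entropy (gibbs L β') ≤ potential L β' := by
  rw [← objective_gibbs L hβ']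
  have := potential_le_objective L hβ (gibbs_mem L β')
  rw [regularizer] at this ⊢
  linarith

/-- Regret of follow-the-regularized-leader with the entropic regularizer. -/
lemma ftrl_regret {L ℓ : ℕ → Fin K → ℝ} {β : ℕ → ℝ} (n : ℕ) (hL0 : L 0 = 0)
    (hL : ∀ t < n, L (t + 1) = L t + ℓ t) (hβ : ∀ t, 0 < β t) (hℓ : ∀ t < n, ∀ a, |ℓ t a| ≤ β t)
    (a : Fin K) :
    ∑ t ∈ Finset.range n, ((∑ b, gibbs (L t) (β t) b * ℓ t b) - ℓ t a) ≤
      β 0 * Real.log K + ∑ t ∈ Finset.range n, (β (t + 1) - β t) *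
        entropy (gibbs (L (t + 1)) (β (t + 1))) +
      ∑ t ∈ Finset.range n, 1 / β t * ∑ b, gibbs (L t) (β t) b * ℓ t b ^ 2 := by
  -- The potential telescopes. Each round first adds the loss at the old rate (stability) and then
  -- changes the rate at the new cumulative loss (penalty), so the entropy is that of the next
  -- distribution.
  have main : ∀ m ≤ n, ∑ t ∈ Finset.range m, (∑ b, gibbs (L t) (β t) b * ℓ t b) ≤
      potential (L m) (β m) + β 0 * Real.log K + ∑ t ∈ Finset.range m, (β (t + 1) - β t) *
        entropy (gibbs (L (t + 1)) (β (t + 1))) +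
      ∑ t ∈ Finset.range m, 1 / β t * ∑ b, gibbs (L t) (β t) b * ℓ t b ^ 2 := by
    intro m
    induction m with
    | zero => intro _; simp [hL0, potential_zero]
    | succ m ih =>
      intro hm
      have h := ih (by omega)
      have h1 := potential_add_ge (L m) (hβ m) (hℓ m (by omega))
      rw [← hL m (by omega)] at h1
      have h2 := potential_rate_ge (L (m + 1)) (hβ m) (hβ (m + 1))
      simp only [Finset.sum_range_succ]
      linarith
  have hLn : ∀ m ≤ n, L m a = ∑ t ∈ Finset.range m, ℓ t a := by
    intro m
    induction m with
    | zero => intro _; simp [hL0]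
    | succ m ih =>
      intro hm
      rw [hL m (by omega), Pi.add_apply, ih (by omega), Finset.sum_range_succ]
  have h1 := main n le_rfl
  have h2 := potential_le_apply (L n) (hβ n) a
  rw [hLn n le_rfl] at h2
  rw [Finset.sum_sub_distrib]
  linarith

end Gibbs

/-! ### Deterministic sums for the adaptive learning rate -/

section LearningRate

variable {h β : ℕ → ℝ} {L : ℝ} {n : ℕ}

lemma div_le_two_mul_sqrt_sub {w x : ℝ} (hw : 0 ≤ w) (hpos : 0 < w + x) :
    x / Real.sqrt (w + x) ≤ 2 * (Real.sqrt (w + x) - Real.sqrt w) := by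
  have hs := Real.sqrt_pos.mpr hpos
  rw [div_le_iff₀ hs]
  have h1 := Real.mul_self_sqrt hpos.le
  have h2 := Real.mul_self_sqrt hw
  nlinarith [sq_nonneg (Real.sqrt (w + x) - Real.sqrt w)]

/-- The penalty part of the adaptive learning rate. -/
lemma sum_rate_mul_le (hL : 0 < L) (h0 : h 0 = L) (hn : ∀ t ≤ n, 0 ≤ h t) (hle : ∀ t ≤ n, h t ≤ L) :
    ∑ t ∈ Finset.range n, 1 / Real.sqrt (1 + L⁻¹ * ∑ s ∈ Finset.range (t + 1), h s) * h (t + 1) ≤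
      2 * (Real.sqrt L * Real.sqrt (∑ s ∈ Finset.range (n + 1), h s)) := by
  induction n with
  | zero => simp; positivity
  | succ n ih =>
    have ih := ih (fun t ht => hn t (by omega)) (fun t ht => hle t (by omega))
    rw [Finset.sum_range_succ, Finset.sum_range_succ _ (n + 1)]
    set w := ∑ s ∈ Finset.range (n + 1), h s with hw
    have hwL : L ≤ w := by
      rw [← h0, hw]
      exact Finset.single_le_sum (f := h)
        (fun t ht => hn t (by have := Finset.mem_range.mp ht; omega)) (by simp)
    have hx := hn (n + 1) le_rfl
    have hxL := hle (n + 1) le_rfl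
    have h1 := div_le_two_mul_sqrt_sub (hL.le.trans hwL) (x := h (n + 1)) (by linarith)
    -- Since h (n + 1) ≤ L, the partial sum may be advanced by one term: w + h (n + 1) ≤ L (1 + w /
    -- L). The sum of h / √(w + h) then telescopes in square roots.
    have h2 : 1 / Real.sqrt (1 + L⁻¹ * w) ≤ Real.sqrt L / Real.sqrt (w + h (n + 1)) := by
      have hLw : 0 ≤ L⁻¹ * w := mul_nonneg (inv_nonneg.mpr hL.le) (hL.le.trans hwL)
      rw [← Real.sqrt_div hL.le, one_div, ← Real.sqrt_inv, ← one_div]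
      apply Real.sqrt_le_sqrt
      rw [div_le_div_iff₀ (by positivity) (by linarith)]
      field_simp
      linarith
    have h3 := mul_le_mul_of_nonneg_right h2 hx
    have h4 := mul_le_mul_of_nonneg_left h1 (Real.sqrt_nonneg L)
    have h5 : Real.sqrt L / Real.sqrt (w + h (n + 1)) * h (n + 1) =
        Real.sqrt L * (h (n + 1) / Real.sqrt (w + h (n + 1))) := by ring
    linarith

lemma sum_one_div_add_one_le_one_add_log (n : ℕ) :
    ∑ t ∈ Finset.range n, 1 / ((t : ℝ) + 1) ≤ 1 + Real.log n := by
  have h := harmonic_le_one_add_log n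
  rw [harmonic] at h
  push_cast at h
  simpa [one_div] using h

/-- The stability part of the adaptive learning rate. -/
lemma sum_inv_rate_le (hL : 0 < L) (h0 : h 0 = L) (hn : ∀ t < n, 0 ≤ h t) (hnpos : 0 < n)
    (hβ0 : 0 < β 0)
    (hβ : ∀ t < n, β (t + 1) = β t + β 0 *
      (1 / Real.sqrt (1 + L⁻¹ * ∑ s ∈ Finset.range (t + 1), h s))) :
    ∑ t ∈ Finset.range n, 1 / β t ≤
      1 / β 0 * (2 * (Real.sqrt (∑ s ∈ Finset.range n, h s) / Real.sqrt L)) *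
        (1 + Real.log n) := by
  set w := ∑ s ∈ Finset.range n, h s with hw
  have hmono : ∀ t ≤ n, ∑ s ∈ Finset.range t, h s ≤ w := fun t ht =>
    Finset.sum_le_sum_of_subset_of_nonneg (Finset.range_subset_range.mpr ht)
      fun s hs _ => hn s (Finset.mem_range.mp hs)
  have hnn : ∀ t ≤ n, 0 ≤ ∑ s ∈ Finset.range t, h s := fun t ht =>
    Finset.sum_nonneg fun s hs => hn s (by have := Finset.mem_range.mp hs; omega)
  have hwL : L ≤ w := by
    have := hmono 1 hnpos
    simpa [h0] using this
  have hw0 : 0 < w := hL.trans_le hwL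
  set r := Real.sqrt (1 + L⁻¹ * w) with hr
  have hr1 : 1 ≤ r := Real.one_le_sqrt.mpr (by
    have : 0 ≤ L⁻¹ * w := by positivity
    linarith)
  have hr0 : 0 < r := one_pos.trans_le hr1
  -- Every increment is at least β 0 / r, with r taken at the final sum, and r ≥ 1 covers the
  -- initial value. So β grows linearly and the sum of 1 / β is harmonic.
  have hlow : ∀ t < n, β 0 * ((t + 1 : ℝ) / r) ≤ β t := by
    intro t
    induction t with
    | zero =>
      intro _
      have : ((0 : ℕ) + 1 : ℝ) / r ≤ 1 := by
        rw [div_le_one hr0]; simpa using hr1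
      nlinarith
    | succ t ih =>
      intro ht
      have h1 := ih (by omega)
      rw [hβ t (by omega)]
      have h2 : 1 / r ≤ 1 / Real.sqrt (1 + L⁻¹ * ∑ s ∈ Finset.range (t + 1), h s) := by
        have h3 := hnn (t + 1) (by omega)
        have h5 : 0 ≤ L⁻¹ * ∑ s ∈ Finset.range (t + 1), h s := by positivity
        refine one_div_le_one_div_of_le (Real.sqrt_pos.mpr (by linarith)) (Real.sqrt_le_sqrt ?_)
        have h4 := hmono (t + 1) (by omega)
        gcongr
      have h3 := mul_le_mul_of_nonneg_left h2 hβ0.le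
      have h4 : ((t + 1 : ℕ) + 1 : ℝ) / r = (t + 1 : ℝ) / r + 1 / r := by
        push_cast; ring
      rw [h4, mul_add]
      linarith
  -- The first term h 0 = L gives w ≥ L, which absorbs the 1 under the root.
  have hrle : r ≤ 2 * (Real.sqrt w / Real.sqrt L) := by
    rw [← Real.sqrt_div hw0.le, hr]
    refine Real.sqrt_le_iff.mpr ⟨by positivity, ?_⟩
    rw [mul_pow, Real.sq_sqrt (by positivity)]
    have : 1 ≤ w / L := (one_le_div hL).mpr hwL
    rw [inv_mul_eq_div]
    linarith
  calc ∑ t ∈ Finset.range n, 1 / β t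
      ≤ ∑ t ∈ Finset.range n, 1 / β 0 * r * (1 / ((t : ℝ) + 1)) := by
        refine Finset.sum_le_sum fun t ht => ?_
        have h1 := hlow t (Finset.mem_range.mp ht)
        refine (one_div_le_one_div_of_le (by positivity) h1).trans (le_of_eq ?_)
        field_simp
    _ = 1 / β 0 * r * ∑ t ∈ Finset.range n, 1 / ((t : ℝ) + 1) := by rw [Finset.mul_sum]
    _ ≤ _ := by
        have h1 := sum_one_div_add_one_le_one_add_log n
        have h2 : (0:ℝ) ≤ ∑ t ∈ Finset.range n, 1 / ((t : ℝ) + 1) :=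
          Finset.sum_nonneg fun t _ => by positivity
        gcongr

end LearningRate

/-! ### Measurability of states, matrix inverses and entropy -/

section StateSpace

variable {d : ℕ}

instance : MeasurableSpace (State d) :=
  MeasurableSpace.comap (fun σ => (σ.cumEst, σ.invRate, σ.cumEnt)) inferInstance

lemma measurable_tuple :
    Measurable fun σ : State d => (σ.cumEst, σ.invRate, σ.cumEnt) :=
  comap_measurable _

lemma measurable_cumEst : Measurable (State.cumEst : State d → Fin d → ℝ) :=
  measurable_fst.comp measurable_tuple

lemma measurable_invRate : Measurable (State.invRate : State d → ℝ) :=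
  (measurable_fst.comp measurable_snd).comp measurable_tuple

lemma measurable_cumEnt : Measurable (State.cumEnt : State d → ℝ) :=
  (measurable_snd.comp measurable_snd).comp measurable_tuple

lemma measurable_to_state {α : Type*} [MeasurableSpace α] {f : α → State d}
    (h₁ : Measurable fun a => (f a).cumEst) (h₂ : Measurable fun a => (f a).invRate)
    (h₃ : Measurable fun a => (f a).cumEnt) : Measurable f :=
  measurable_comap_iff.mpr (h₁.prodMk (h₂.prodMk h₃))

end StateSpace

/-- The inverse is the adjugate times the inverse determinant, a formula valid for singular matrices
too under the convention that their inverse is zero. No invertibility is therefore needed. -/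
lemma measurable_matrix_inv {α : Type*} [MeasurableSpace α] {d : ℕ}
    {M : α → Matrix (Fin d) (Fin d) ℝ} (hM : ∀ i j, Measurable fun a => M a i j) (i j : Fin d) :
    Measurable fun a => (M a)⁻¹ i j := by
  have hdet : ∀ {N : α → Matrix (Fin d) (Fin d) ℝ}, (∀ i j, Measurable fun a => N a i j) →
      Measurable fun a => (N a).det := fun hN => by
    simp only [Matrix.det_apply]
    exact Finset.measurable_fun_sum _ fun σ _ =>
      (Finset.measurable_fun_prod _ fun i _ => hN _ _).const_smul _
  simp only [Matrix.inv_def, Ring.inverse_eq_inv', Matrix.smul_apply, smul_eq_mul,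
    Matrix.adjugate_apply]
  refine (hdet hM).inv.mul (hdet fun k l => ?_)
  by_cases hk : k = j
  · subst hk
    simp only [Matrix.updateRow_self]
    exact measurable_const
  · simp only [Matrix.updateRow_ne hk]
    exact hM k l

lemma measurable_entropy {K : ℕ} : Measurable (entropy : (Fin K → ℝ) → ℝ) :=
  Finset.measurable_fun_sum _ fun a _ =>
    Real.continuous_negMulLog.measurable.comp (measurable_pi_apply a)

/-! ### The algorithm as a function of its state -/

section Algorithm

variable {𝒳 : Type*} [MeasurableSpace 𝒳] {K d : ℕ} {S : Setting 𝒳 K d} {𝒵 : Set (Fin d → ℝ)}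

namespace Setting

/-- The standing assumptions on what the decision-maker knows. -/
structure Regular (S : Setting 𝒳 K d) (𝒵 : Set (Fin d → ℝ)) : Prop extends S.Admissible 𝒵 where
  two_le_arms : 2 ≤ K
  two_le_rounds : 2 ≤ S.T
  rate_le : S.rate₁ / S.lam ≤ 1

/-- The states whose learning rate does not exceed the initial one. -/
abbrev Reach (S : Setting 𝒳 K d) : Type := {σ : State d // S.invRate₁ ≤ σ.invRate}

namespace Regular

variable (hS : S.Regular 𝒵)
include hS

lemma log_arms_pos : 0 < Real.log K :=
  Real.log_pos (by exact_mod_cast hS.two_le_arms)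

lemma log_rounds_pos : 0 < Real.log S.T :=
  Real.log_pos (by exact_mod_cast hS.two_le_rounds)

lemma invRate₁_pos : 0 < S.invRate₁ := by
  refine Real.sqrt_pos.mpr (div_pos (mul_pos ?_ hS.log_rounds_pos) hS.log_arms_pos)
  have := one_div_pos.mpr hS.lam_pos
  positivity

lemma invRate_pos (σ : S.Reach) : 0 < σ.1.invRate := hS.invRate₁_pos.trans_le σ.2

lemma mixing_pos (σ : S.Reach) : 0 < S.mixing σ.1 :=
  div_pos (one_div_pos.mpr (hS.invRate_pos σ)) hS.lam_pos

lemma mixing_le_one (σ : S.Reach) : S.mixing σ.1 ≤ 1 :=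
  (div_le_div_of_nonneg_right (one_div_le_one_div_of_le hS.invRate₁_pos σ.2)
    hS.lam_pos.le).trans hS.rate_le

/-- The reason for γ = η/λ: exploration with weight γ bounds the inverse covariance form by 1/(λγ),
which becomes 1/η, the range allowed by the stability estimate. -/
lemma one_div_lam_div_mixing (σ : S.Reach) : 1 / S.lam / S.mixing σ.1 = σ.1.invRate := by
  have := hS.lam_pos.ne'
  have := (hS.invRate_pos σ).ne'
  rw [mixing]
  field_simp

lemma neZero_arms : NeZero K := ⟨by have := hS.two_le_arms; omega⟩

/-- The choice made by `Classical.epsilon` is determined, because the minimizer exists and is unique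
when the inverse rate is positive. Restricting to `S.Reach` ensures this positivity, and the closed
formula makes the policy jointly measurable in state and context. -/
lemma q_eq_gibbs {t : ℕ} (ht : t ≠ 0) (σ : S.Reach) (x : 𝒳) :
    S.q t σ.1 x = gibbs (fun a => σ.1.cumEst ⬝ᵥ S.φ a x) σ.1.invRate := by
  have := hS.neZero_arms
  rw [Setting.q, if_neg ht]
  have hβ := hS.invRate_pos σ
  have hspec := Classical.epsilon_spec (p := fun p : Fin K → ℝ =>
    p ∈ stdSimplex ℝ (Fin K) ∧ IsMinOn (S.objective σ.1 x) (stdSimplex ℝ (Fin K)) p)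
    ⟨gibbs (fun a => σ.1.cumEst ⬝ᵥ S.φ a x) σ.1.invRate, gibbs_mem _ _,
      isMinOn_iff.mpr fun p hp =>
        (objective_gibbs _ hβ).trans_le (potential_le_objective _ hβ hp)⟩
  refine eq_gibbs_of_objective_le _ hβ hspec.1 ?_
  exact (isMinOn_iff.mp hspec.2 _ (gibbs_mem _ _)).trans_eq (objective_gibbs _ hβ)

lemma q_mem (t : ℕ) (σ : S.Reach) (x : 𝒳) : S.q t σ.1 x ∈ stdSimplex ℝ (Fin K) := by
  have := hS.neZero_arms
  rcases eq_or_ne t 0 with rfl | ht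
  · have := gibbs_mem (0 : Fin K → ℝ) 1
    rwa [gibbs_zero] at this
  · rw [hS.q_eq_gibbs ht]
    exact gibbs_mem _ _

lemma measurable_q (t : ℕ) : Measurable fun p : S.Reach × 𝒳 => S.q t p.1.1 p.2 := by
  rcases eq_or_ne t 0 with rfl | ht
  · exact measurable_const
  · simp only [hS.q_eq_gibbs ht]
    have hL : ∀ a, Measurable fun p : S.Reach × 𝒳 =>
        Real.exp (-((p.1.1.cumEst ⬝ᵥ S.φ a p.2) / p.1.1.invRate)) := fun a => by
      have h1 : Measurable fun p : S.Reach × 𝒳 => p.1.1.cumEst :=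
        measurable_cumEst.comp (measurable_subtype_coe.comp measurable_fst)
      have h2 : Measurable fun p : S.Reach × 𝒳 => p.1.1.invRate :=
        measurable_invRate.comp (measurable_subtype_coe.comp measurable_fst)
      have h3 : Measurable fun p : S.Reach × 𝒳 => S.φ a p.2 :=
        (hS.measurable_φ a).comp measurable_snd
      refine Real.measurable_exp.comp (Measurable.neg (Measurable.div ?_ h2))
      exact Finset.measurable_fun_sum _ fun i _ =>
        ((measurable_pi_apply i).comp h1).mul ((measurable_pi_apply i).comp h3)
    refine measurable_pi_lambda _ fun a => ?_
    exact (hL a).div (Finset.measurable_fun_sum _ fun b _ => hL b)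

lemma isPolicy_q (t : ℕ) (σ : S.Reach) : IsPolicy (S.q t σ.1) :=
  { measurable := Measurable.of_uncurry_left (f := fun (σ : S.Reach) x => S.q t σ.1 x)
      (hS.measurable_q t)
    mem := hS.q_mem t σ }

lemma mixing_mul_explo_le (t : ℕ) (σ : S.Reach) (x : 𝒳) (a : Fin K) :
    S.mixing σ.1 * S.explo x a ≤ S.policy t σ.1 x a :=
  le_add_of_nonneg_left (mul_nonneg (sub_nonneg.mpr (hS.mixing_le_one σ)) ((hS.q_mem t σ x).1 a))

lemma one_sub_mixing_mul_q_le (t : ℕ) (σ : S.Reach) (x : 𝒳) (a : Fin K) :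
    (1 - S.mixing σ.1) * S.q t σ.1 x a ≤ S.policy t σ.1 x a :=
  le_add_of_nonneg_right (mul_nonneg (hS.mixing_pos σ).le ((hS.explo_mem x).1 a))

omit hS in
lemma measurable_mixing : Measurable fun σ : S.Reach => S.mixing σ.1 :=
  ((measurable_invRate.comp measurable_subtype_coe).const_div 1).div_const _

lemma measurable_policy (t : ℕ) :
    Measurable fun p : S.Reach × 𝒳 => S.policy t p.1.1 p.2 := by
  refine measurable_pi_lambda _ fun a => ?_
  have h1 : Measurable fun p : S.Reach × 𝒳 => S.mixing p.1.1 :=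
    measurable_mixing.comp measurable_fst
  exact ((h1.const_sub 1).mul ((measurable_pi_apply a).comp (hS.measurable_q t))).add
    (h1.mul ((measurable_pi_apply a).comp (hS.measurable_explo.comp measurable_snd)))

lemma policy_mem (t : ℕ) (σ : S.Reach) (x : 𝒳) : S.policy t σ.1 x ∈ stdSimplex ℝ (Fin K) := by
  refine ⟨fun a => (mul_nonneg (hS.mixing_pos σ).le ((hS.explo_mem x).1 a)).trans
    (hS.mixing_mul_explo_le t σ x a), ?_⟩
  simp only [policy, Finset.sum_add_distrib, ← Finset.mul_sum, (hS.q_mem t σ x).2,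
    (hS.explo_mem x).2]
  ring

lemma isPolicy_policy (t : ℕ) (σ : S.Reach) : IsPolicy (S.policy t σ.1) :=
  { measurable := Measurable.of_uncurry_left (f := fun (σ : S.Reach) x => S.policy t σ.1 x)
      (hS.measurable_policy t)
    mem := hS.policy_mem t σ }

lemma isUnit_covariance_policy (t : ℕ) (σ : S.Reach) : IsUnit (S.covariance (S.policy t σ.1)) :=
  hS.toAdmissible.isUnit_covariance (hS.isPolicy_policy t σ) (hS.mixing_pos σ)
    (hS.mixing_mul_explo_le t σ)

lemma abs_form_le (t : ℕ) (σ : S.Reach) (a b : Fin K) (x y : 𝒳) :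
    |S.φ a x ⬝ᵥ ((S.covariance (S.policy t σ.1))⁻¹ *ᵥ S.φ b y)| ≤ σ.1.invRate := by
  rw [← hS.one_div_lam_div_mixing σ]
  exact hS.toAdmissible.abs_inv_covariance_form_le (hS.isPolicy_policy t σ) (hS.mixing_pos σ)
    (hS.mixing_mul_explo_le t σ) (hS.φ_mem a x) (hS.φ_mem b y)

lemma integrable_form_inv {p : 𝒳 → Fin K → ℝ} (hp : IsPolicy p) (t : ℕ) (σ : S.Reach) :
    Integrable (fun x => ∑ a, p x a *
      (S.φ a x ⬝ᵥ ((S.covariance (S.policy t σ.1))⁻¹ *ᵥ S.φ a x))) S.G := by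
  have := hS.prob
  refine integrable_finsetSum _ fun a _ => integrable_policy_mul hp ?_ a
  refine Integrable.of_bound (C := σ.1.invRate) (Measurable.aestronglyMeasurable ?_)
    (.of_forall fun x => hS.abs_form_le t σ a a x x)
  have hm : ∀ i, Measurable fun x => S.φ a x i := fun i =>
    (measurable_pi_apply i).comp (hS.measurable_φ a)
  refine Finset.measurable_fun_sum _ fun i _ => (hm i).mul ?_
  simp only [Matrix.mulVec, dotProduct]
  exact Finset.measurable_fun_sum _ fun j _ => (hm j).const_mul _

/-- The expected squared dual norm of the features under the FTRL distribution. -/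
lemma integral_q_form_le (t : ℕ) (σ : S.Reach) :
    ∫ x, ∑ a, S.q t σ.1 x a *
      (S.φ a x ⬝ᵥ ((S.covariance (S.policy t σ.1))⁻¹ *ᵥ S.φ a x)) ∂S.G ≤
      2 * (1 / S.lam + d) := by
  have := hS.prob
  have hlam : 0 < 1 / S.lam := one_div_pos.mpr hS.lam_pos
  have hint := hS.integrable_form_inv (hS.isPolicy_q t σ) t σ
  -- If γ ≤ 1/2 then q ≤ 2π, and under π the mean is the trace d. If γ ≥ 1/2 every single form is at
  -- most 1/(λγ) ≤ 2/λ.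
  rcases le_total (S.mixing σ.1) (1 / 2) with h | h
  · have h1 := hS.toAdmissible.integral_inv_covariance_form (hS.isPolicy_policy t σ)
      (hS.isUnit_covariance_policy t σ)
    have h2 : ∫ x, ∑ a, S.q t σ.1 x a *
        (S.φ a x ⬝ᵥ ((S.covariance (S.policy t σ.1))⁻¹ *ᵥ S.φ a x)) ∂S.G ≤ 2 * d := by
      rw [← h1, ← integral_const_mul]
      refine integral_mono hint
        ((hS.integrable_form_inv (hS.isPolicy_policy t σ) t σ).const_mul 2) fun x => ?_
      simp only [Finset.mul_sum]
      refine Finset.sum_le_sum fun a _ => ?_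
      rw [← mul_assoc]
      refine mul_le_mul_of_nonneg_right ?_ (inv_form_nonneg (hS.isUnit_covariance_policy t σ)
        (hS.toAdmissible.covariance_form_nonneg (hS.isPolicy_policy t σ)) _)
      have h3 := hS.one_sub_mixing_mul_q_le t σ x a
      have h4 := (hS.q_mem t σ x).1 a
      nlinarith
    linarith
  · have h2 : ∫ x, ∑ a, S.q t σ.1 x a *
        (S.φ a x ⬝ᵥ ((S.covariance (S.policy t σ.1))⁻¹ *ᵥ S.φ a x)) ∂S.G ≤
        ∫ _, 2 * (1 / S.lam) ∂S.G := by
      refine integral_mono hint (integrable_const _) fun x => ?_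
      have h3 : ∀ a, S.φ a x ⬝ᵥ ((S.covariance (S.policy t σ.1))⁻¹ *ᵥ S.φ a x) ≤
          2 * (1 / S.lam) := fun a => by
        refine (le_abs_self _).trans ((hS.abs_form_le t σ a a x x).trans ?_)
        rw [← hS.one_div_lam_div_mixing σ, div_le_iff₀ (hS.mixing_pos σ)]
        nlinarith
      calc _ ≤ ∑ a, S.q t σ.1 x a * (2 * (1 / S.lam)) := Finset.sum_le_sum fun a _ =>
            mul_le_mul_of_nonneg_left (h3 a) ((hS.q_mem t σ x).1 a)
        _ = _ := by rw [← Finset.sum_mul, (hS.q_mem t σ x).2, one_mul]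
    rw [integral_const, probReal_univ, one_smul] at h2
    have : (0 : ℝ) ≤ d := Nat.cast_nonneg d
    linarith

lemma measurable_covariance_policy (t : ℕ) (i j : Fin d) :
    Measurable fun σ : S.Reach => S.covariance (S.policy t σ.1) i j := by
  have := hS.prob
  have hm : ∀ a i, Measurable fun p : S.Reach × 𝒳 => S.φ a p.2 i := fun a i =>
    ((measurable_pi_apply i).comp (hS.measurable_φ a)).comp measurable_snd
  have : Measurable fun p : S.Reach × 𝒳 =>
      ∑ a, S.policy t p.1.1 p.2 a * (S.φ a p.2 i * S.φ a p.2 j) :=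
    Finset.measurable_fun_sum _ fun a _ =>
      ((measurable_pi_apply a).comp (hS.measurable_policy t)).mul ((hm a i).mul (hm a j))
  exact this.stronglyMeasurable.integral_prod_right'.measurable

lemma measurable_inv_mulVec {α : Type*} [MeasurableSpace α] (t : ℕ) {σ : α → S.Reach}
    {v : α → Fin d → ℝ} (hσ : Measurable σ) (hv : Measurable v) :
    Measurable fun a => (S.covariance (S.policy t (σ a).1))⁻¹ *ᵥ v a := by
  refine measurable_pi_lambda _ fun i => ?_
  simp only [Matrix.mulVec, dotProduct]
  refine Finset.measurable_fun_sum _ fun j _ => ?_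
  exact (measurable_matrix_inv (fun i j => (hS.measurable_covariance_policy t i j).comp hσ)
    i j).mul ((measurable_pi_apply j).comp hv)

lemma measurable_φ_uncurry : Measurable fun p : Fin K × 𝒳 => S.φ p.1 p.2 :=
  measurable_from_prod_countable_right fun a => hS.measurable_φ a

lemma measurable_estimate (t : ℕ) :
    Measurable fun p : S.Reach × (𝒳 × Fin K × ℝ) => S.estimate t p.1.1 p.2 := by
  have hφ : Measurable fun p : S.Reach × (𝒳 × Fin K × ℝ) => S.φ p.2.2.1 p.2.1 :=
    hS.measurable_φ_uncurry.comp
      ((measurable_fst.comp (measurable_snd.comp measurable_snd)).prodMk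
        (measurable_fst.comp measurable_snd))
  exact (measurable_snd.comp (measurable_snd.comp measurable_snd)).smul
    (hS.measurable_inv_mulVec t measurable_fst hφ)

lemma measurable_update (t : ℕ) :
    Measurable fun p : S.Reach × (𝒳 × Fin K × ℝ) => S.update t p.1.1 p.2 := by
  have h1 : Measurable fun p : S.Reach × (𝒳 × Fin K × ℝ) => (p.1 : State d) :=
    measurable_subtype_coe.comp measurable_fst
  have hent : Measurable fun p : S.Reach × (𝒳 × Fin K × ℝ) =>
      p.1.1.cumEnt + entropy (S.q t p.1.1 p.2.1) := by
    have h2 : Measurable fun p : S.Reach × (𝒳 × Fin K × ℝ) => ((p.1, p.2.1) : S.Reach × 𝒳) :=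
      measurable_fst.prodMk (measurable_fst.comp measurable_snd)
    have h3 := measurable_entropy.comp ((hS.measurable_q t).comp h2)
    exact (measurable_cumEnt.comp h1).add h3
  refine measurable_to_state ?_ ?_ hent
  · exact (measurable_cumEst.comp h1).add (hS.measurable_estimate t)
  · exact (measurable_invRate.comp h1).add
      ((((hent.const_mul _).const_add _).sqrt.const_div 1).const_mul _)

end Regular

lemma invRate₁_le_invRate_state (S : Setting 𝒳 K d) (o : ℕ → 𝒳 × Fin K × ℝ) (t : ℕ) :
    S.invRate₁ ≤ (S.state o t).invRate := by
  induction t with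
  | zero => exact le_rfl
  | succ t ih =>
    exact ih.trans (le_add_of_nonneg_right (mul_nonneg (Real.sqrt_nonneg _)
      (one_div_nonneg.mpr (Real.sqrt_nonneg _))))

/-- The state at the beginning of round `t`, with the bound on its learning rate. -/
def reach (S : Setting 𝒳 K d) (o : ℕ → 𝒳 × Fin K × ℝ) (t : ℕ) : S.Reach :=
  ⟨S.state o t, S.invRate₁_le_invRate_state o t⟩

lemma cumEnt_state (S : Setting 𝒳 K d) (o : ℕ → 𝒳 × Fin K × ℝ) (t : ℕ) :
    (S.state o t).cumEnt =
      ∑ s ∈ Finset.range t, entropy (S.q s (S.state o s) (o s).1) := by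
  induction t with
  | zero => simp [state]
  | succ t ih => rw [Finset.sum_range_succ, ← ih]; rfl

lemma invRate_state_succ (S : Setting 𝒳 K d) (o : ℕ → 𝒳 × Fin K × ℝ) (t : ℕ) :
    (S.state o (t + 1)).invRate = (S.state o t).invRate + S.invRate₁ *
      (1 / Real.sqrt (1 + (Real.log K)⁻¹ * (S.state o (t + 1)).cumEnt)) := rfl

namespace Regular

variable (hS : S.Regular 𝒵)
include hS

lemma cumEnt_nonneg (o : ℕ → 𝒳 × Fin K × ℝ) (t : ℕ) : 0 ≤ (S.state o t).cumEnt := by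
  rw [cumEnt_state]
  exact Finset.sum_nonneg fun s _ => entropy_nonneg (hS.q_mem s (S.reach o s) _)

lemma one_div_sqrt_le_one {c : ℝ} (hc : 0 ≤ c) :
    1 / Real.sqrt (1 + (Real.log K)⁻¹ * c) ≤ 1 := by
  have : 0 ≤ (Real.log K)⁻¹ * c := mul_nonneg (inv_nonneg.mpr hS.log_arms_pos.le) hc
  have h1 : 1 ≤ Real.sqrt (1 + (Real.log K)⁻¹ * c) := Real.one_le_sqrt.mpr (by linarith)
  exact (div_le_one (by linarith)).mpr h1

/-- Each increment is at most 1/η_1. This crude deterministic bound is used for integrability only;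
it does not enter the regret bound. -/
lemma invRate_state_le (o : ℕ → 𝒳 × Fin K × ℝ) (t : ℕ) :
    (S.state o t).invRate ≤ (t + 1) * S.invRate₁ := by
  induction t with
  | zero => simp [state]
  | succ t ih =>
    rw [invRate_state_succ]
    have := mul_le_mul_of_nonneg_left (hS.one_div_sqrt_le_one (hS.cumEnt_nonneg o (t + 1)))
      hS.invRate₁_pos.le
    push_cast
    linarith

end Regular

end Setting

end Algorithm

/-! ### Histories and measurability of the random state -/

section Rounds

variable {Ω 𝒳 : Type*} [mΩ : MeasurableSpace Ω] [MeasurableSpace 𝒳] {K d : ℕ}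
  (I : Interaction Ω 𝒳 K d) (S : Setting 𝒳 K d) {𝒵 Θ : Set (Fin d → ℝ)} {μ : Measure Ω}

namespace Interaction

/-- The random state of the algorithm at the beginning of round `t`. -/
def reach (t : ℕ) (ω : Ω) : S.Reach := S.reach (I.obs S ω) t

variable {I S}

omit mΩ in
lemma history_mono {s t : ℕ} (h : s ≤ t) : I.history S s ≤ I.history S t :=
  iSup₂_le fun r hr => le_iSup₂_of_le r
    (Finset.mem_range.mpr ((Finset.mem_range.mp hr).trans_le h)) le_rfl

omit mΩ in
lemma measurable_obs_history {s t : ℕ} (h : s < t) :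
    Measurable[I.history S t] fun ω => I.obs S ω s :=
  (comap_measurable _).mono (le_iSup₂_of_le s (Finset.mem_range.mpr h) le_rfl) le_rfl

omit mΩ in
lemma measurable_reach (hS : S.Regular 𝒵) (t : ℕ) :
    Measurable[I.history S t] (I.reach S t) := by
  induction t with
  | zero => exact @measurable_const _ _ _ (I.history S 0) (⟨⟨0, S.invRate₁, 0⟩, le_rfl⟩ : S.Reach)
  | succ t ih =>
    have h1 : Measurable[I.history S (t + 1)] (I.reach S t) :=
      ih.mono (history_mono t.le_succ) le_rfl
    have h2 := (hS.measurable_update t).comp (h1.prodMk (measurable_obs_history t.lt_succ_self))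
    exact h2.subtype_mk

omit mΩ in
lemma measurable_loss_comp (hS : S.Regular 𝒵) {m : MeasurableSpace Ω} {t : ℕ} {A : Ω → Fin K}
    {X : Ω → 𝒳}
    (hA : Measurable[m] A) (hX : Measurable[m] X) (hθ : Measurable[m] (I.θ t))
    (hε : Measurable[m] (I.ε t)) : Measurable[m] fun ω => I.loss S t (A ω) (X ω) ω := by
  have h1 : Measurable[m] fun ω => S.φ (A ω) (X ω) :=
    hS.measurable_φ_uncurry.comp (hA.prodMk hX)
  have h2 : Measurable fun p : Fin K × (Fin K → ℝ) => p.2 p.1 :=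
    measurable_from_prod_countable_right fun a => measurable_pi_apply a
  refine Measurable.add ?_ (h2.comp (hA.prodMk hε))
  exact Finset.measurable_fun_sum _ fun i _ =>
    ((measurable_pi_apply i).comp h1).mul ((measurable_pi_apply i).comp hθ)

/-- The induction is needed because an observed loss involves `θ_s`, which is measurable only
through the earlier history. -/
lemma history_le (hS : S.Regular 𝒵) (hI : I.IsRun S μ 𝒵 Θ) {t : ℕ} (ht : t ≤ S.T) :
    I.history S t ≤ mΩ := by
  induction t with
  | zero => exact iSup₂_le fun s hs => absurd hs (by simp)
  | succ t ih =>
    refine iSup₂_le fun s hs => ?_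
    have hs' : s ≤ t := Nat.lt_succ_iff.mp (Finset.mem_range.mp hs)
    have hsT : s < S.T := by omega
    have hθ : Measurable (I.θ s) :=
      (hI.measurable_θ s hsT).mono ((history_mono hs').trans (ih (by omega))) le_rfl
    refine Measurable.comap_le ((hI.measurable_X s hsT).prodMk
      ((hI.measurable_A s hsT).prodMk ?_))
    exact measurable_loss_comp hS (hI.measurable_A s hsT) (hI.measurable_X s hsT) hθ
      (hI.measurable_ε s hsT)

end Interaction

end Rounds

lemma integrable_of_ae_abs_le {α : Type*} [MeasurableSpace α] {ν : Measure α} [IsFiniteMeasure ν]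
    {f : α → ℝ} (hf : Measurable f) {M : ℝ} (hM : ∀ᵐ a ∂ν, |f a| ≤ M) : Integrable f ν :=
  Integrable.of_bound hf.aestronglyMeasurable M hM

lemma ae_prod_of_ae_forall {α β : Type*} [MeasurableSpace α] [MeasurableSpace β] {ν : Measure α}
    {κ : Measure β} [SFinite κ] {P : α → β → Prop} (h : ∀ᵐ a ∂ν, ∀ b, P a b) :
    ∀ᵐ p ∂ν.prod κ, P p.1 p.2 :=
  (Measure.quasiMeasurePreserving_fst.ae h).mono fun p hp => hp p.2

lemma abs_mul_le_of_abs_le {x y M N : ℝ} (hx : |x| ≤ M) (hy : |y| ≤ N) : |x * y| ≤ M * N := by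
  rw [abs_mul]
  exact mul_le_mul hx hy (abs_nonneg _) ((abs_nonneg _).trans hx)

lemma abs_sum_mul_le {K : ℕ} {p f : Fin K → ℝ} {M : ℝ} (hp : p ∈ stdSimplex ℝ (Fin K))
    (hf : ∀ a, |f a| ≤ M) : |∑ a, p a * f a| ≤ M :=
  calc |∑ a, p a * f a| ≤ ∑ a, |p a * f a| := Finset.abs_sum_le_sum_abs _ _
    _ ≤ ∑ a, p a * M := Finset.sum_le_sum fun a _ => by
        rw [abs_mul, abs_of_nonneg (hp.1 a)]
        exact mul_le_mul_of_nonneg_left (hf a) (hp.1 a)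
    _ = M := by rw [← Finset.sum_mul, hp.2, one_mul]

lemma measurable_dotProduct {α : Type*} [MeasurableSpace α] {d : ℕ} {u v : α → Fin d → ℝ}
    (hu : Measurable u) (hv : Measurable v) : Measurable fun a => u a ⬝ᵥ v a :=
  Finset.measurable_fun_sum _ fun i _ =>
    ((measurable_pi_apply i).comp hu).mul ((measurable_pi_apply i).comp hv)

/-! ### Conditional expectations within a round, and moments of the estimate -/

section Rounds

variable {Ω 𝒳 : Type*} [mΩ : MeasurableSpace Ω] [MeasurableSpace 𝒳] {K d : ℕ}
  {I : Interaction Ω 𝒳 K d} {S : Setting 𝒳 K d} {𝒵 Θ : Set (Fin d → ℝ)} {μ : Measure Ω}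

/-- The σ-algebra of the history and the context of a round. -/
abbrev Interaction.known (I : Interaction Ω 𝒳 K d) (S : Setting 𝒳 K d) (t : ℕ) :
    MeasurableSpace Ω :=
  I.history S t ⊔ MeasurableSpace.comap (I.X t) inferInstance

/-- The σ-algebra of the history, the context and the losses of a round. -/
abbrev Interaction.full (I : Interaction Ω 𝒳 K d) (S : Setting 𝒳 K d) (t : ℕ) :
    MeasurableSpace Ω :=
  I.known S t ⊔ MeasurableSpace.comap (I.ε t) inferInstance

namespace Interaction.IsRun

variable (hI : I.IsRun S μ 𝒵 Θ) (hS : S.Regular 𝒵) {t : ℕ}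
include hI hS

lemma measurable_reach (ht : t ≤ S.T) : Measurable (I.reach S t) :=
  (Interaction.measurable_reach hS t).mono (history_le hS hI ht) le_rfl

lemma measurable_param (ht : t < S.T) : Measurable (I.θ t) :=
  (hI.measurable_θ t ht).mono (history_le hS hI ht.le) le_rfl

lemma measurable_obs (ht : t < S.T) : Measurable fun ω => I.obs S ω t :=
  (measurable_obs_history t.lt_succ_self).mono (history_le hS hI ht) le_rfl

lemma abs_linear_le (ht : t < S.T) : ∀ᵐ ω ∂μ, ∀ a x, |S.φ a x ⬝ᵥ I.θ t ω| ≤ 1 := by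
  filter_upwards [hI.θ_mem t ht] with ω h a x
  exact hI.linear_bound _ (hS.φ_mem a x) _ h

lemma abs_noise_le (ht : t < S.T) : ∀ᵐ ω ∂μ, ∀ a, |I.ε t ω a| ≤ 2 := by
  filter_upwards [hI.abs_linear_le hS ht, hI.loss_bound t ht] with ω h1 h2 a
  have h3 := h1 a (I.X t ω)
  have h4 := h2 a (I.X t ω)
  rw [loss] at h4
  rw [abs_le] at *
  constructor <;> linarith

lemma full_le (ht : t < S.T) : I.full S t ≤ mΩ :=
  sup_le (sup_le (history_le hS hI ht.le) (hI.measurable_X t ht).comap_le)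
    (hI.measurable_ε t ht).comap_le

variable [IsProbabilityMeasure μ]

/-- Expand f at `A_t` by the indicators of `A_t = a` and pull f a out of the conditional
expectation. The function may depend on the noise of the round, since the arm is drawn conditionally
on it as well. -/
lemma integral_draw (ht : t < S.T) {f : Fin K → Ω → ℝ}
    (hf : ∀ a, Measurable[I.full S t] (f a)) {M : ℝ}
    (hM : ∀ᵐ ω ∂μ, ∀ a, |f a ω| ≤ M) :
    ∫ ω, f (I.A t ω) ω ∂μ =
      ∫ ω, ∑ a, S.policy t (I.reach S t ω).1 (I.X t ω) a * f a ω ∂μ := by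
  have hle := hI.full_le hS ht
  have hint : ∀ a, Integrable (f a) μ := fun a =>
    integrable_of_ae_abs_le ((hf a).mono hle le_rfl) (hM.mono fun ω h => h a)
  have hA : ∀ a, MeasurableSet (I.A t ⁻¹' {a}) := fun a =>
    hI.measurable_A t ht (measurableSet_singleton a)
  have hmul : ∀ a, Integrable (fun ω =>
      f a ω * (I.A t ⁻¹' {a}).indicator (fun _ => (1 : ℝ)) ω) μ := fun a => by
    refine ((hint a).indicator (hA a)).congr (.of_forall fun ω => ?_)
    by_cases h : ω ∈ I.A t ⁻¹' {a} <;> simp [h]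
  have key : ∀ a, f a * μ[(I.A t ⁻¹' {a}).indicator (fun _ => (1 : ℝ)) |
      I.full S t] =ᵐ[μ]
      fun ω => S.policy t (I.reach S t ω).1 (I.X t ω) a * f a ω := fun a => by
    filter_upwards [hI.draw t ht a] with ω h
    rw [Pi.mul_apply, h, mul_comm]
    rfl
  have key2 := fun a => condExp_mul_of_stronglyMeasurable_left (μ := μ)
    (hf a).stronglyMeasurable (hmul a) ((integrable_const (1 : ℝ)).indicator (hA a))
  have hpol : ∀ a, Integrable
      (fun ω => S.policy t (I.reach S t ω).1 (I.X t ω) a * f a ω) μ := fun a =>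
    (integrable_congr ((key2 a).trans (key a))).mp integrable_condExp
  calc ∫ ω, f (I.A t ω) ω ∂μ
      = ∫ ω, ∑ a, f a ω * (I.A t ⁻¹' {a}).indicator (fun _ => (1 : ℝ)) ω ∂μ := by
        refine integral_congr_ae (.of_forall fun ω => ?_)
        refine ((Finset.sum_eq_single (I.A t ω) (fun a _ ha => ?_) (by simp)).trans ?_).symm
        · have h : ω ∉ I.A t ⁻¹' {a} := fun h => ha (Set.mem_singleton_iff.mp h).symm
          rw [Set.indicator_of_notMem h, mul_zero]
        · have h : ω ∈ I.A t ⁻¹' {I.A t ω} := Set.mem_singleton _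
          rw [Set.indicator_of_mem h, mul_one]
    _ = ∑ a, ∫ ω, S.policy t (I.reach S t ω).1 (I.X t ω) a * f a ω ∂μ := by
        rw [integral_finsetSum _ fun a _ => hmul a]
        refine Finset.sum_congr rfl fun a _ => ?_
        rw [← integral_congr_ae ((key2 a).trans (key a)), integral_condExp hle]
        rfl
    _ = _ := (integral_finsetSum _ fun a _ => hpol a).symm

lemma integral_noise_mul (ht : t < S.T) (a : Fin K) {f : Ω → ℝ}
    (hf : Measurable[I.known S t] f) {M : ℝ}
    (hM : ∀ᵐ ω ∂μ, |f ω| ≤ M) : ∫ ω, f ω * I.ε t ω a ∂μ = 0 := by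
  have hle := le_sup_left.trans (hI.full_le hS ht)
  have hε : Measurable fun ω => I.ε t ω a :=
    (measurable_pi_apply a).comp (hI.measurable_ε t ht)
  have hεi : Integrable (fun ω => I.ε t ω a) μ :=
    integrable_of_ae_abs_le hε ((hI.abs_noise_le hS ht).mono fun ω h => h a)
  have hmul : Integrable (fun ω => f ω * I.ε t ω a) μ := by
    refine integrable_of_ae_abs_le (((hf.mono hle le_rfl)).mul hε) (M := M * 2) ?_
    filter_upwards [hM, hI.abs_noise_le hS ht] with ω h1 h2
    exact abs_mul_le_of_abs_le h1 (h2 a)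
  have key := condExp_mul_of_stronglyMeasurable_left (μ := μ) hf.stronglyMeasurable hmul hεi
  rw [← integral_condExp hle]
  refine (integral_congr_ae key).trans ?_
  refine (integral_congr_ae (g := fun _ => 0) ?_).trans (integral_zero _ _)
  filter_upwards [hI.noise t ht a] with ω h
  rw [Pi.mul_apply, h, Pi.zero_apply, mul_zero]

/-- The context of a round may be replaced by an independent copy. -/
lemma map_context (ht : t < S.T) :
    μ.map (fun ω => ((I.reach S t ω, I.θ t ω), I.X t ω)) =
      (μ.prod S.G).map fun p => ((I.reach S t p.1, I.θ t p.1), p.2) := by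
  have := hS.prob
  have hH : Measurable[I.history S t] fun ω => (I.reach S t ω, I.θ t ω) :=
    (Interaction.measurable_reach hS t).prodMk (hI.measurable_θ t ht)
  have hH' : Measurable fun ω => (I.reach S t ω, I.θ t ω) :=
    hH.mono (history_le hS hI ht.le) le_rfl
  have hind : IndepFun (fun ω => (I.reach S t ω, I.θ t ω)) (I.X t) μ := by
    rw [IndepFun_iff_Indep]
    exact indep_of_indep_of_le_left (hI.indep_X t ht).symm hH.comap_le
  rw [(indepFun_iff_map_prod_eq_prod_map_map hH'.aemeasurable
    (hI.measurable_X t ht).aemeasurable).mp hind, hI.law_X t ht]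
  have := Measure.map_prod_map μ S.G hH' measurable_id
  rw [Measure.map_id] at this
  exact this

lemma integral_context (ht : t < S.T) {g : (S.Reach × (Fin d → ℝ)) × 𝒳 → ℝ}
    (hg : Measurable g) :
    ∫ ω, g ((I.reach S t ω, I.θ t ω), I.X t ω) ∂μ =
      ∫ p, g ((I.reach S t p.1, I.θ t p.1), p.2) ∂(μ.prod S.G) := by
  have hH : Measurable fun ω => (I.reach S t ω, I.θ t ω) :=
    (hI.measurable_reach hS ht.le).prodMk (hI.measurable_param hS ht)
  have h1 := integral_map (μ := μ) (hH.prodMk (hI.measurable_X t ht)).aemeasurable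
    hg.aestronglyMeasurable
  have h2 := integral_map (μ := μ.prod S.G)
    ((hH.comp measurable_fst).prodMk measurable_snd).aemeasurable hg.aestronglyMeasurable
  rw [← h1, hI.map_context hS ht]
  exact h2

omit mΩ hI [IsProbabilityMeasure μ] in
lemma invRate_reach_le (t : ℕ) (ω : Ω) :
    (I.reach S t ω).1.invRate ≤ (t + 1) * S.invRate₁ :=
  hS.invRate_state_le _ _

/-- The loss-free counterpart of `integral_loss_mul`, for second moments in which the squared loss
has already been bounded by one. -/
lemma integral_arm (ht : t < S.T) {g : Fin K → S.Reach × 𝒳 → ℝ} (hg : ∀ a, Measurable (g a))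
    {M : ℝ} (hM : ∀ ω a x, |g a (I.reach S t ω, x)| ≤ M) :
    ∫ ω, g (I.A t ω) (I.reach S t ω, I.X t ω) ∂μ =
      ∫ p, ∑ a, S.policy t (I.reach S t p.1).1 p.2 a * g a (I.reach S t p.1, p.2)
        ∂(μ.prod S.G) := by
  have h := hI.integral_draw hS ht (f := fun a ω => g a (I.reach S t ω, I.X t ω)) (fun a =>
    (hg a).comp ((((Interaction.measurable_reach hS t).mono (le_sup_left.trans le_sup_left)
      le_rfl)).prodMk ((comap_measurable (I.X t)).mono (le_sup_right.trans le_sup_left) le_rfl)))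
    (M := M) (.of_forall fun ω a => hM ω a _)
  rw [h]
  refine hI.integral_context hS ht (g := fun p =>
    ∑ a, S.policy t p.1.1.1 p.2 a * g a (p.1.1, p.2)) ?_
  have h1 : Measurable fun p : (S.Reach × (Fin d → ℝ)) × 𝒳 => (p.1.1, p.2) :=
    (measurable_fst.comp measurable_fst).prodMk measurable_snd
  exact Finset.measurable_fun_sum _ fun a _ =>
    ((measurable_pi_apply a).comp ((hS.measurable_policy t).comp h1)).mul ((hg a).comp h1)

/-- Averaging over the arm comes first. The loss then splits into its linear part and the noise; the
weight of the noise is known before the noise is drawn, so that part vanishes. A fresh context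
finally replaces `X_t`. -/
lemma integral_loss_mul (ht : t < S.T) {g : Fin K → S.Reach × 𝒳 → ℝ}
    (hg : ∀ a, Measurable (g a)) {M : ℝ} (hM : ∀ ω a x, |g a (I.reach S t ω, x)| ≤ M) :
    ∫ ω, I.loss S t (I.A t ω) (I.X t ω) ω * g (I.A t ω) (I.reach S t ω, I.X t ω) ∂μ =
      ∫ p, ∑ a, S.policy t (I.reach S t p.1).1 p.2 a * ((S.φ a p.2 ⬝ᵥ I.θ t p.1) *
        g a (I.reach S t p.1, p.2)) ∂(μ.prod S.G) := by
  have hle := hI.full_le hS ht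
  have hR' : Measurable[I.known S t] (I.reach S t) :=
    (Interaction.measurable_reach hS t).mono le_sup_left le_rfl
  have hX' : Measurable[I.known S t] (I.X t) := (comap_measurable (I.X t)).mono le_sup_right le_rfl
  have hθ' : Measurable[I.known S t] (I.θ t) := (hI.measurable_θ t ht).mono le_sup_left le_rfl
  have hε : Measurable[I.full S t] (I.ε t) := (comap_measurable (I.ε t)).mono le_sup_right le_rfl
  have hRX' : Measurable[I.known S t] fun ω => (I.reach S t ω, I.X t ω) := hR'.prodMk hX'
  have hpol' : ∀ a, Measurable[I.known S t] fun ω => S.policy t (I.reach S t ω).1 (I.X t ω) a := fun a =>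
    (measurable_pi_apply a).comp ((hS.measurable_policy t).comp hRX')
  have hg' : ∀ a, Measurable[I.known S t] fun ω => g a (I.reach S t ω, I.X t ω) := fun a =>
    (hg a).comp hRX'
  have hlin' : ∀ a, Measurable[I.known S t] fun ω => S.φ a (I.X t ω) ⬝ᵥ I.θ t ω := fun a =>
    Finset.measurable_fun_sum _ fun i _ =>
      ((measurable_pi_apply i).comp ((hS.measurable_φ a).comp hX')).mul
        ((measurable_pi_apply i).comp hθ')
  have hεm : ∀ a, Measurable fun ω => I.ε t ω a := fun a =>
    (measurable_pi_apply a).comp (hI.measurable_ε t ht)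
  have hle' : I.known S t ≤ mΩ := le_sup_left.trans hle
  have hpolb : ∀ ω a, |S.policy t (I.reach S t ω).1 (I.X t ω) a| ≤ 1 := fun ω a => by
    rw [abs_of_nonneg ((hS.policy_mem t _ _).1 a)]
    exact le_one_of_mem_stdSimplex (hS.policy_mem t _ _) a
  have hpg : ∀ a, Measurable[I.known S t] fun ω =>
      S.policy t (I.reach S t ω).1 (I.X t ω) a * g a (I.reach S t ω, I.X t ω) := fun a =>
    (hpol' a).mul (hg' a)
  have hpgb : ∀ ω a, |S.policy t (I.reach S t ω).1 (I.X t ω) a *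
      g a (I.reach S t ω, I.X t ω)| ≤ 1 * M := fun ω a =>
    abs_mul_le_of_abs_le (hpolb ω a) (hM ω a _)
  have hi1 : ∀ a, Integrable (fun ω => S.policy t (I.reach S t ω).1 (I.X t ω) a *
      ((S.φ a (I.X t ω) ⬝ᵥ I.θ t ω) * g a (I.reach S t ω, I.X t ω))) μ := fun a => by
    refine integrable_of_ae_abs_le (((hpol' a).mul ((hlin' a).mul (hg' a))).mono hle' le_rfl)
      (M := 1 * (1 * M)) ?_
    filter_upwards [hI.abs_linear_le hS ht] with ω h
    exact abs_mul_le_of_abs_le (hpolb ω a) (abs_mul_le_of_abs_le (h a _) (hM ω a _))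
  have hi2 : ∀ a, Integrable (fun ω => S.policy t (I.reach S t ω).1 (I.X t ω) a *
      g a (I.reach S t ω, I.X t ω) * I.ε t ω a) μ := fun a => by
    refine integrable_of_ae_abs_le (((hpg a).mono hle' le_rfl).mul (hεm a))
      (M := 1 * M * 2) ?_
    filter_upwards [hI.abs_noise_le hS ht] with ω h
    exact abs_mul_le_of_abs_le (hpgb ω a) (h a)
  have h := hI.integral_draw hS ht
    (f := fun a ω => I.loss S t a (I.X t ω) ω * g a (I.reach S t ω, I.X t ω)) (fun a =>
      ((((hlin' a).mono le_sup_left le_rfl).add ((measurable_pi_apply a).comp hε)).mul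
        ((hg' a).mono le_sup_left le_rfl)))
    (M := 1 * M) (by
      filter_upwards [hI.loss_bound t ht] with ω h a
      exact abs_mul_le_of_abs_le (h a _) (hM ω a _))
  rw [h]
  have hsplit : ∀ ω, ∑ a, S.policy t (I.reach S t ω).1 (I.X t ω) a *
      (I.loss S t a (I.X t ω) ω * g a (I.reach S t ω, I.X t ω)) =
      ∑ a, S.policy t (I.reach S t ω).1 (I.X t ω) a *
        ((S.φ a (I.X t ω) ⬝ᵥ I.θ t ω) * g a (I.reach S t ω, I.X t ω)) +
      ∑ a, S.policy t (I.reach S t ω).1 (I.X t ω) a *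
        g a (I.reach S t ω, I.X t ω) * I.ε t ω a := fun ω => by
    rw [← Finset.sum_add_distrib]
    refine Finset.sum_congr rfl fun a _ => ?_
    rw [loss]
    ring
  simp only [hsplit]
  rw [integral_add (integrable_finsetSum _ fun a _ => hi1 a)
    (integrable_finsetSum _ fun a _ => hi2 a), integral_finsetSum _ fun a _ => hi2 a,
    Finset.sum_eq_zero fun a _ =>
      hI.integral_noise_mul hS ht a (hpg a) (.of_forall fun ω => hpgb ω a), add_zero]
  refine hI.integral_context hS ht (g := fun p => ∑ a, S.policy t p.1.1.1 p.2 a *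
    ((S.φ a p.2 ⬝ᵥ p.1.2) * g a (p.1.1, p.2))) ?_
  have h1 : Measurable fun p : (S.Reach × (Fin d → ℝ)) × 𝒳 => (p.1.1, p.2) :=
    (measurable_fst.comp measurable_fst).prodMk measurable_snd
  exact Finset.measurable_fun_sum _ fun a _ =>
    ((measurable_pi_apply a).comp ((hS.measurable_policy t).comp h1)).mul
      ((measurable_dotProduct ((hS.measurable_φ a).comp measurable_snd)
        (measurable_snd.comp measurable_fst)).mul ((hg a).comp h1))

/-- The parameter estimate of the algorithm in round `t`. -/
def _root_.LinBandit.Interaction.est (I : Interaction Ω 𝒳 K d) (S : Setting 𝒳 K d) (t : ℕ)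
    (ω : Ω) : Fin d → ℝ := S.estimate t (I.reach S t ω).1 (I.obs S ω t)

omit mΩ hI hS [IsProbabilityMeasure μ] in
-- Symmetry of Σ⁻¹ moves it onto z, so that estimates are controlled by the inverse covariance form.
lemma est_dotProduct (t : ℕ) (ω : Ω) (z : Fin d → ℝ) :
    I.est S t ω ⬝ᵥ z = I.loss S t (I.A t ω) (I.X t ω) ω * (S.φ (I.A t ω) (I.X t ω) ⬝ᵥ
      ((S.covariance (S.policy t (I.reach S t ω).1))⁻¹ *ᵥ z)) := by
  rw [est, Setting.estimate, smul_dotProduct, smul_eq_mul,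
    dotProduct_mulVec_symm (inv_isSymm (covariance_isSymm _)) (S.φ _ _) z, dotProduct_comm]
  rfl

omit [IsProbabilityMeasure μ] in
lemma measurable_est (ht : t < S.T) : Measurable (I.est S t) :=
  (hS.measurable_estimate t).comp
    ((hI.measurable_reach hS ht.le).prodMk (hI.measurable_obs hS ht))

omit [IsProbabilityMeasure μ] in
lemma abs_est_le (ht : t < S.T) :
    ∀ᵐ ω ∂μ, ∀ b x, |I.est S t ω ⬝ᵥ S.φ b x| ≤ (I.reach S t ω).1.invRate := by
  filter_upwards [hI.loss_bound t ht] with ω h b x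
  rw [est_dotProduct]
  refine (abs_mul_le_of_abs_le (h _ _) (hS.abs_form_le t _ _ b _ x)).trans_eq (one_mul _)

omit hI [IsProbabilityMeasure μ] in
lemma measurable_form (t : ℕ) {c : S.Reach → ℝ} (hc : Measurable c) (z : Fin d → ℝ) (a : Fin K)
    (k : ℕ) :
    Measurable fun p : S.Reach × 𝒳 => c p.1 *
      (S.φ a p.2 ⬝ᵥ ((S.covariance (S.policy t p.1.1))⁻¹ *ᵥ z)) ^ k :=
  (hc.comp measurable_fst).mul ((measurable_dotProduct ((hS.measurable_φ a).comp measurable_snd)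
    (hS.measurable_inv_mulVec t measurable_fst measurable_const)).pow_const k)

omit mΩ hI [IsProbabilityMeasure μ] in
lemma abs_form_pow_le (t : ℕ) {c : S.Reach → ℝ} {M : ℝ} (hM : ∀ ω, |c (I.reach S t ω)| ≤ M)
    (ω : Ω) (a b : Fin K) (x y : 𝒳) (k : ℕ) :
    |c (I.reach S t ω) * (S.φ a y ⬝ᵥ ((S.covariance (S.policy t (I.reach S t ω).1))⁻¹ *ᵥ
      S.φ b x)) ^ k| ≤ M * ((t + 1) * S.invRate₁) ^ k := by
  refine abs_mul_le_of_abs_le (hM ω) ?_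
  rw [abs_pow]
  exact pow_le_pow_left₀ (abs_nonneg _)
    ((hS.abs_form_le t _ a b y x).trans (invRate_reach_le hS t ω)) k

/-- The parameter estimate is unbiased. -/
lemma integral_est (ht : t < S.T) {c : S.Reach → ℝ} (hc : Measurable c) {M : ℝ}
    (hM : ∀ ω, |c (I.reach S t ω)| ≤ M) (b : Fin K) (x : 𝒳) :
    ∫ ω, c (I.reach S t ω) * (I.est S t ω ⬝ᵥ S.φ b x) ∂μ =
      ∫ ω, c (I.reach S t ω) * (S.φ b x ⬝ᵥ I.θ t ω) ∂μ := by
  have := hS.prob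
  -- The weight c depends on the state only; it will be the probability of arm b at a fixed context
  -- x, less the comparator's indicator.
  have h := hI.integral_loss_mul hS ht (fun a => measurable_form hS t hc (S.φ b x) a 1)
    (M := M * ((t + 1) * S.invRate₁) ^ 1) (fun ω a y => abs_form_pow_le hS t hM ω a b x y 1)
  simp only [pow_one] at h
  have hl : ∀ ω, c (I.reach S t ω) * (I.est S t ω ⬝ᵥ S.φ b x) =
      I.loss S t (I.A t ω) (I.X t ω) ω * (c (I.reach S t ω) * (S.φ (I.A t ω) (I.X t ω) ⬝ᵥ
      ((S.covariance (S.policy t (I.reach S t ω).1))⁻¹ *ᵥ S.φ b x))) := fun ω => by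
    rw [est_dotProduct]; ring
  simp only [hl]
  rw [h, integral_prod]
  · congr 1 with ω
    have hp := hS.isPolicy_policy t (I.reach S t ω)
    have h2 := hS.toAdmissible.dotProduct_covariance hp (I.θ t ω)
      ((S.covariance (S.policy t (I.reach S t ω).1))⁻¹ *ᵥ S.φ b x)
    -- Averaging φ φᵀ over the arm and the context gives Σ, which cancels Σ⁻¹.
    rw [mulVec_inv_mulVec (hS.isUnit_covariance_policy t _)] at h2
    rw [dotProduct_comm (S.φ b x), h2, ← integral_const_mul]
    congr 1 with y
    rw [Finset.mul_sum]
    exact Finset.sum_congr rfl fun a _ => by ring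
  · refine integrable_of_ae_abs_le (M := 1 * (M * ((t + 1) * S.invRate₁) ^ 1)) ?_ ?_
    · have h1 : Measurable fun p : Ω × 𝒳 => (I.reach S t p.1, p.2) :=
        ((hI.measurable_reach hS ht.le).comp measurable_fst).prodMk measurable_snd
      have h2 := fun a => (measurable_form hS t hc (S.φ b x) a 1).comp h1
      simp only [pow_one] at h2
      exact Finset.measurable_fun_sum _ fun a _ =>
        ((measurable_pi_apply a).comp ((hS.measurable_policy t).comp h1)).mul
        ((measurable_dotProduct ((hS.measurable_φ a).comp measurable_snd)
          ((hI.measurable_param hS ht).comp measurable_fst)).mul (h2 a))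
    · have h3 : ∀ᵐ ω ∂μ, ∀ y, |∑ a, S.policy t (I.reach S t ω).1 y a *
          ((S.φ a y ⬝ᵥ I.θ t ω) * (c (I.reach S t ω) * (S.φ a y ⬝ᵥ
          ((S.covariance (S.policy t (I.reach S t ω).1))⁻¹ *ᵥ S.φ b x))))| ≤
          1 * (M * ((t + 1) * S.invRate₁) ^ 1) := by
        filter_upwards [hI.abs_linear_le hS ht] with ω h y
        refine abs_sum_mul_le (hS.policy_mem t _ _) fun a =>
          abs_mul_le_of_abs_le (h a y) ?_
        simpa only [pow_one] using abs_form_pow_le hS t hM ω a b x y 1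
      exact ae_prod_of_ae_forall h3

/-- The second moment of the parameter estimate. -/
lemma integral_est_sq_le (ht : t < S.T) {c : S.Reach → ℝ} (hc : Measurable c) {M : ℝ}
    (hM : ∀ ω, |c (I.reach S t ω)| ≤ M) (hnn : ∀ σ, 0 ≤ c σ) (b : Fin K) (x : 𝒳) :
    ∫ ω, c (I.reach S t ω) * (I.est S t ω ⬝ᵥ S.φ b x) ^ 2 ∂μ ≤
      ∫ ω, c (I.reach S t ω) * (S.φ b x ⬝ᵥ
        ((S.covariance (S.policy t (I.reach S t ω).1))⁻¹ *ᵥ S.φ b x)) ∂μ := by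
  have := hS.prob
  have hmeas := fun a => measurable_form hS t hc (S.φ b x) a 2
  have hbd := fun ω a y => abs_form_pow_le hS t hM ω a b x y 2
  have h := hI.integral_arm hS ht hmeas (M := M * ((t + 1) * S.invRate₁) ^ 2) hbd
  have hreach := hI.measurable_reach hS ht.le
  -- The squared loss is dropped, being at most one. The remaining mean is exact by Σ⁻¹ Σ Σ⁻¹ = Σ⁻¹.
  have hstep : ∫ ω, c (I.reach S t ω) * (I.est S t ω ⬝ᵥ S.φ b x) ^ 2 ∂μ ≤
      ∫ ω, c (I.reach S t ω) * (S.φ (I.A t ω) (I.X t ω) ⬝ᵥ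
        ((S.covariance (S.policy t (I.reach S t ω).1))⁻¹ *ᵥ S.φ b x)) ^ 2 ∂μ := by
    refine integral_mono_ae ?_ ?_ ?_
    · refine integrable_of_ae_abs_le ((hc.comp hreach).mul
        ((measurable_dotProduct (hI.measurable_est hS ht) measurable_const).pow_const 2))
        (M := M * ((t + 1) * S.invRate₁) ^ 2) ?_
      filter_upwards [hI.abs_est_le hS ht] with ω h
      refine abs_mul_le_of_abs_le (hM ω) ?_
      rw [abs_pow]
      exact pow_le_pow_left₀ (abs_nonneg _) ((h b x).trans (invRate_reach_le hS t ω)) 2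
    · refine integrable_of_ae_abs_le ?_ (.of_forall fun ω => hbd ω (I.A t ω) (I.X t ω))
      exact (hc.comp hreach).mul ((measurable_dotProduct
        (hS.measurable_φ_uncurry.comp ((hI.measurable_A t ht).prodMk (hI.measurable_X t ht)))
        (hS.measurable_inv_mulVec t hreach measurable_const)).pow_const 2)
    · filter_upwards [hI.loss_bound t ht] with ω h
      refine mul_le_mul_of_nonneg_left ?_ (hnn _)
      rw [est_dotProduct, mul_pow]
      refine mul_le_of_le_one_left (sq_nonneg _) ?_
      rw [sq_le_one_iff_abs_le_one]
      exact h _ _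
  refine hstep.trans (le_of_eq ?_)
  rw [h, integral_prod]
  · congr 1 with ω
    have hp := hS.isPolicy_policy t (I.reach S t ω)
    have h2 := hS.toAdmissible.dotProduct_covariance hp
      ((S.covariance (S.policy t (I.reach S t ω).1))⁻¹ *ᵥ S.φ b x)
      ((S.covariance (S.policy t (I.reach S t ω).1))⁻¹ *ᵥ S.φ b x)
    rw [mulVec_inv_mulVec (hS.isUnit_covariance_policy t _), dotProduct_comm] at h2
    rw [h2, ← integral_const_mul]
    congr 1 with y
    rw [Finset.mul_sum]
    exact Finset.sum_congr rfl fun a _ => by ring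
  · refine integrable_of_ae_abs_le (M := M * ((t + 1) * S.invRate₁) ^ 2) ?_
      (.of_forall fun p => abs_sum_mul_le (hS.policy_mem t _ _) fun a => hbd p.1 a p.2)
    have h1 : Measurable fun p : Ω × 𝒳 => (I.reach S t p.1, p.2) :=
      (hreach.comp measurable_fst).prodMk measurable_snd
    exact Finset.measurable_fun_sum _ fun a _ =>
      ((measurable_pi_apply a).comp ((hS.measurable_policy t).comp h1)).mul ((hmeas a).comp h1)

end Interaction.IsRun

end Rounds

/-- Arms are added one at a time, each compared with the current best; the comparison set is
measurable, so the selector stays measurable. -/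
lemma exists_measurable_argmin {α : Type*} [MeasurableSpace α] {K : ℕ} [NeZero K]
    {f : Fin K → α → ℝ} (hf : ∀ a, Measurable (f a)) :
    ∃ ρ : α → Fin K, Measurable ρ ∧ ∀ x a, f (ρ x) x ≤ f a x := by
  suffices h : ∀ s : Finset (Fin K), ∃ ρ : α → Fin K, Measurable ρ ∧
      ∀ x, ∀ a ∈ s, f (ρ x) x ≤ f a x by
    obtain ⟨ρ, h1, h2⟩ := h Finset.univ
    exact ⟨ρ, h1, fun x a => h2 x a (Finset.mem_univ a)⟩
  have hfu : Measurable fun p : Fin K × α => f p.1 p.2 := measurable_from_prod_countable_right hf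
  intro s
  induction s using Finset.induction with
  | empty => exact ⟨fun _ => 0, measurable_const, by simp⟩
  | insert a s _ ih =>
    obtain ⟨ρ, h1, h2⟩ := ih
    refine ⟨fun x => if f a x ≤ f (ρ x) x then a else ρ x,
      Measurable.ite (measurableSet_le (hf a) (hfu.comp (h1.prodMk measurable_id)))
        measurable_const h1, fun x b hb => ?_⟩
    rcases Finset.mem_insert.mp hb with rfl | hb
    · by_cases h : f b x ≤ f (ρ x) x
      · simp [h]
      · simp only [h, if_false]; exact (not_le.mp h).le
    · by_cases h : f a x ≤ f (ρ x) x
      · simp only [h, if_true]; exact h.trans (h2 x b hb)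
      · simp only [h, if_false]; exact h2 x b hb

/-! ### Optimal comparators and the decomposition of the regret -/

section Rounds

variable {Ω 𝒳 : Type*} [mΩ : MeasurableSpace Ω] [MeasurableSpace 𝒳] {K d : ℕ}
  {I : Interaction Ω 𝒳 K d} {S : Setting 𝒳 K d} {𝒵 Θ : Set (Fin d → ℝ)} {μ : Measure Ω}

namespace Interaction.IsRun

variable (hI : I.IsRun S μ 𝒵 Θ) (hS : S.Regular 𝒵) {t : ℕ}
include hI hS

lemma measurable_reach_prod (ht : t ≤ S.T) :
    Measurable fun p : Ω × 𝒳 => (I.reach S t p.1, p.2) :=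
  ((hI.measurable_reach hS ht).comp measurable_fst).prodMk measurable_snd

lemma measurable_linear {ρ : 𝒳 → Fin K} (hρ : Measurable ρ) (ht : t < S.T) :
    Measurable fun p : Ω × 𝒳 => S.φ (ρ p.2) p.2 ⬝ᵥ I.θ t p.1 :=
  measurable_dotProduct
    (hS.measurable_φ_uncurry.comp ((hρ.comp measurable_snd).prodMk measurable_snd))
    ((hI.measurable_param hS ht).comp measurable_fst)

variable [IsProbabilityMeasure μ]

lemma integrable_linear {ρ : 𝒳 → Fin K} (hρ : Measurable ρ) (ht : t < S.T) :
    Integrable (fun p : Ω × 𝒳 => S.φ (ρ p.2) p.2 ⬝ᵥ I.θ t p.1) (μ.prod S.G) := by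
  have := hS.prob
  have h : ∀ᵐ ω ∂μ, ∀ x, |S.φ (ρ x) x ⬝ᵥ I.θ t ω| ≤ 1 :=
    (hI.abs_linear_le hS ht).mono fun ω h x => h _ x
  exact integrable_of_ae_abs_le (hI.measurable_linear hS hρ ht) (ae_prod_of_ae_forall h)

lemma integrable_policy_linear {p : S.Reach × 𝒳 → Fin K → ℝ} (hp : Measurable p)
    (hmem : ∀ z, p z ∈ stdSimplex ℝ (Fin K)) (ht : t < S.T) :
    Integrable (fun z : Ω × 𝒳 => ∑ a, p (I.reach S t z.1, z.2) a * (S.φ a z.2 ⬝ᵥ I.θ t z.1))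
      (μ.prod S.G) := by
  have := hS.prob
  have h : ∀ᵐ ω ∂μ, ∀ x, |∑ a, p (I.reach S t ω, x) a * (S.φ a x ⬝ᵥ I.θ t ω)| ≤ 1 :=
    (hI.abs_linear_le hS ht).mono fun ω h x => abs_sum_mul_le (hmem _) fun a => h a x
  refine integrable_of_ae_abs_le (Finset.measurable_fun_sum _ fun a _ => ?_)
    (ae_prod_of_ae_forall h)
  exact ((measurable_pi_apply a).comp (hp.comp (hI.measurable_reach_prod hS ht.le))).mul
    (hI.measurable_linear hS measurable_const ht)

lemma integral_linear {ρ : 𝒳 → Fin K} (hρ : Measurable ρ) (ht : t < S.T) :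
    ∫ ω, S.φ (ρ (I.X t ω)) (I.X t ω) ⬝ᵥ I.θ t ω ∂μ =
      ∫ p, S.φ (ρ p.2) p.2 ⬝ᵥ I.θ t p.1 ∂(μ.prod S.G) :=
  hI.integral_context hS ht (g := fun p => S.φ (ρ p.2) p.2 ⬝ᵥ p.1.2)
    (measurable_dotProduct
      (hS.measurable_φ_uncurry.comp ((hρ.comp measurable_snd).prodMk measurable_snd))
      (measurable_snd.comp measurable_fst))

lemma integrable_linear_context {ρ : 𝒳 → Fin K} (hρ : Measurable ρ) (ht : t < S.T) :
    Integrable (fun ω => S.φ (ρ (I.X t ω)) (I.X t ω) ⬝ᵥ I.θ t ω) μ :=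
  integrable_of_ae_abs_le ((hI.measurable_linear hS hρ ht).comp
    (measurable_id.prodMk (hI.measurable_X t ht)))
    ((hI.abs_linear_le hS ht).mono fun _ h => h _ _)

lemma integral_sum_linear {ρ : 𝒳 → Fin K} (hρ : Measurable ρ) :
    ∫ ω, ∑ t ∈ Finset.range S.T, S.φ (ρ (I.X t ω)) (I.X t ω) ⬝ᵥ I.θ t ω ∂μ =
      ∑ t ∈ Finset.range S.T, ∫ p, S.φ (ρ p.2) p.2 ⬝ᵥ I.θ t p.1 ∂(μ.prod S.G) := by
  rw [integral_finsetSum _ fun t ht =>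
    hI.integrable_linear_context hS hρ (Finset.mem_range.mp ht)]
  exact Finset.sum_congr rfl fun t ht => hI.integral_linear hS hρ (Finset.mem_range.mp ht)

/-- With a fresh context the objective is an integral over x of an expression in ρ(x) and x alone,
so it is minimized context by context. -/
lemma exists_isOptimal : ∃ ρ, I.IsOptimal S μ ρ := by
  have := hS.prob
  have := hS.neZero_arms
  have hmeas : ∀ t < S.T, ∀ a, Measurable fun x => ∫ ω, S.φ a x ⬝ᵥ I.θ t ω ∂μ :=
    fun t ht a => by
      have h := hI.measurable_linear hS (ρ := fun _ => a) measurable_const ht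
      exact h.stronglyMeasurable.integral_prod_left'.measurable
  obtain ⟨ρ, hρ, hmin⟩ := exists_measurable_argmin
    (f := fun a x => ∑ t ∈ Finset.range S.T, ∫ ω, S.φ a x ⬝ᵥ I.θ t ω ∂μ)
    (fun a => Finset.measurable_fun_sum _ fun t ht => hmeas t (Finset.mem_range.mp ht) a)
  refine ⟨ρ, hρ, fun ρ' hρ' => ?_⟩
  have hobj : ∀ ρ : 𝒳 → Fin K, Measurable ρ →
      Integrable (fun x => ∑ t ∈ Finset.range S.T, ∫ ω, S.φ (ρ x) x ⬝ᵥ I.θ t ω ∂μ) S.G ∧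
      ∫ ω, ∑ t ∈ Finset.range S.T, S.φ (ρ (I.X t ω)) (I.X t ω) ⬝ᵥ I.θ t ω ∂μ =
      ∫ x, ∑ t ∈ Finset.range S.T, ∫ ω, S.φ (ρ x) x ⬝ᵥ I.θ t ω ∂μ ∂S.G := fun ρ hρ => by
    have hint : ∀ t ∈ Finset.range S.T,
        Integrable (fun x => ∫ ω, S.φ (ρ x) x ⬝ᵥ I.θ t ω ∂μ) S.G := fun t ht =>
      (hI.integrable_linear hS hρ (Finset.mem_range.mp ht)).integral_prod_right
    refine ⟨integrable_finsetSum _ hint, ?_⟩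
    rw [hI.integral_sum_linear hS hρ, integral_finsetSum _ hint]
    exact Finset.sum_congr rfl fun t ht =>
      integral_prod_symm _ (hI.integrable_linear hS hρ (Finset.mem_range.mp ht))
  rw [(hobj ρ hρ).2, (hobj ρ' hρ').2]
  exact integral_mono (hobj ρ hρ).1 (hobj ρ' hρ').1 fun x => hmin x (ρ' x)

omit [IsProbabilityMeasure μ] in
lemma measurable_loss {A : Ω → Fin K} (hA : Measurable A) (ht : t < S.T) :
    Measurable fun ω => I.loss S t (A ω) (I.X t ω) ω :=
  measurable_loss_comp hS hA (hI.measurable_X t ht) (hI.measurable_param hS ht)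
    (hI.measurable_ε t ht)

lemma integrable_loss {A : Ω → Fin K} (hA : Measurable A) (ht : t < S.T) :
    Integrable (fun ω => I.loss S t (A ω) (I.X t ω) ω) μ :=
  integrable_of_ae_abs_le (hI.measurable_loss hS hA ht)
    ((hI.loss_bound t ht).mono fun _ h => h _ _)

/-- The noise has conditional mean zero for each fixed arm, so the noise at ρ(X_t) is expanded over
the events ρ(X_t) = a, which are known before the noise. -/
lemma integral_loss_comparator {ρ : 𝒳 → Fin K} (hρ : Measurable ρ) (ht : t < S.T) :
    ∫ ω, I.loss S t (ρ (I.X t ω)) (I.X t ω) ω ∂μ =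
      ∫ p, S.φ (ρ p.2) p.2 ⬝ᵥ I.θ t p.1 ∂(μ.prod S.G) := by
  have hX : Measurable[I.known S t] (I.X t) :=
    (comap_measurable (I.X t)).mono le_sup_right le_rfl
  have hle : I.known S t ≤ mΩ := le_sup_left.trans (hI.full_le hS ht)
  have hf : ∀ a, Measurable[I.known S t] fun ω =>
      Set.indicator {x | ρ x = a} (fun _ => (1 : ℝ)) (I.X t ω) := fun a =>
    (measurable_const.indicator (hρ (measurableSet_singleton a))).comp hX
  have hb : ∀ a ω, |Set.indicator {x | ρ x = a} (fun _ => (1 : ℝ)) (I.X t ω)| ≤ 1 :=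
    fun a ω => by
      by_cases h : I.X t ω ∈ {x | ρ x = a}
      · rw [Set.indicator_of_mem h, abs_one]
      · rw [Set.indicator_of_notMem h, abs_zero]; exact zero_le_one
  have hsplit : ∀ ω, I.loss S t (ρ (I.X t ω)) (I.X t ω) ω =
      S.φ (ρ (I.X t ω)) (I.X t ω) ⬝ᵥ I.θ t ω + ∑ a,
        Set.indicator {x | ρ x = a} (fun _ => (1 : ℝ)) (I.X t ω) * I.ε t ω a := fun ω => by
    rw [loss, Finset.sum_eq_single (ρ (I.X t ω))]
    · have h : I.X t ω ∈ {x | ρ x = ρ (I.X t ω)} := rfl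
      rw [Set.indicator_of_mem h, one_mul]
    · intro a _ ha
      have h : I.X t ω ∉ {x | ρ x = a} := fun h => ha h.symm
      rw [Set.indicator_of_notMem h, zero_mul]
    · simp
  have hint : ∀ a, Integrable (fun ω =>
      Set.indicator {x | ρ x = a} (fun _ => (1 : ℝ)) (I.X t ω) * I.ε t ω a) μ := fun a => by
    refine integrable_of_ae_abs_le (((hf a).mono hle le_rfl).mul
      ((measurable_pi_apply a).comp (hI.measurable_ε t ht))) (M := 1 * 2) ?_
    filter_upwards [hI.abs_noise_le hS ht] with ω h
    exact abs_mul_le_of_abs_le (hb a ω) (h a)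
  simp only [hsplit]
  rw [integral_add (hI.integrable_linear_context hS hρ ht)
    (integrable_finsetSum _ fun a _ => hint a), integral_finsetSum _ fun a _ => hint a,
    Finset.sum_eq_zero fun a _ =>
      hI.integral_noise_mul hS ht a (hf a) (.of_forall (hb a)), add_zero,
    hI.integral_linear hS hρ ht]

lemma integral_loss_arm (ht : t < S.T) :
    ∫ ω, I.loss S t (I.A t ω) (I.X t ω) ω ∂μ =
      ∫ p, ∑ a, S.policy t (I.reach S t p.1).1 p.2 a * (S.φ a p.2 ⬝ᵥ I.θ t p.1)
        ∂(μ.prod S.G) := by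
  have h := hI.integral_loss_mul hS ht (g := fun _ _ => 1) (fun _ => measurable_const) (M := 1)
    (fun _ _ _ => by simp)
  simpa only [mul_one] using h

/-- The regret against a fixed comparator is a sum of one-round regrets with fresh contexts. -/
lemma integral_regret {ρ : 𝒳 → Fin K} (hρ : Measurable ρ) :
    ∫ ω, ∑ t ∈ Finset.range S.T, (I.loss S t (I.A t ω) (I.X t ω) ω -
        I.loss S t (ρ (I.X t ω)) (I.X t ω) ω) ∂μ =
      ∑ t ∈ Finset.range S.T, ((∫ p, ∑ a, S.policy t (I.reach S t p.1).1 p.2 a *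
        (S.φ a p.2 ⬝ᵥ I.θ t p.1) ∂(μ.prod S.G)) -
        ∫ p, S.φ (ρ p.2) p.2 ⬝ᵥ I.θ t p.1 ∂(μ.prod S.G)) := by
  have hA : ∀ t ∈ Finset.range S.T, Integrable (fun ω => I.loss S t (I.A t ω) (I.X t ω) ω) μ :=
    fun t ht => hI.integrable_loss hS (hI.measurable_A t (Finset.mem_range.mp ht))
      (Finset.mem_range.mp ht)
  have hR : ∀ t ∈ Finset.range S.T,
      Integrable (fun ω => I.loss S t (ρ (I.X t ω)) (I.X t ω) ω) μ :=
    fun t ht => hI.integrable_loss hS (hρ.comp (hI.measurable_X t (Finset.mem_range.mp ht)))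
      (Finset.mem_range.mp ht)
  simp only [Finset.sum_sub_distrib]
  rw [integral_sub (integrable_finsetSum _ hA) (integrable_finsetSum _ hR),
    integral_finsetSum _ hA, integral_finsetSum _ hR]
  exact congrArg₂ _
    (Finset.sum_congr rfl fun t ht => hI.integral_loss_arm hS (Finset.mem_range.mp ht))
    (Finset.sum_congr rfl fun t ht =>
      hI.integral_loss_comparator hS hρ (Finset.mem_range.mp ht))

/-- The learner's loss is common to all comparators, and ρ minimizes what is subtracted. -/
lemma regret_le_of_isOptimal {ρ : 𝒳 → Fin K} (hρ : I.IsOptimal S μ ρ) :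
    I.regret S μ ≤ ∑ t ∈ Finset.range S.T, ((∫ p, ∑ a, S.policy t (I.reach S t p.1).1 p.2 a *
        (S.φ a p.2 ⬝ᵥ I.θ t p.1) ∂(μ.prod S.G)) -
        ∫ p, S.φ (ρ p.2) p.2 ⬝ᵥ I.θ t p.1 ∂(μ.prod S.G)) := by
  have : Nonempty {ρ : 𝒳 → Fin K // Measurable ρ} := ⟨⟨ρ, hρ.1⟩⟩
  refine ciSup_le fun ρ' => ?_
  rw [hI.integral_regret hS ρ'.2]
  have h := hρ.2 ρ'.1 ρ'.2
  rw [hI.integral_sum_linear hS hρ.1, hI.integral_sum_linear hS ρ'.2] at h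
  simp only [Finset.sum_sub_distrib]
  linarith

end Interaction.IsRun

end Rounds

/-- The growth of the inverse learning rate that leads to a state. -/
def Setting.increment {𝒳 : Type*} [MeasurableSpace 𝒳] {K d : ℕ} (S : Setting 𝒳 K d)
    (σ : State d) : ℝ :=
  S.invRate₁ * (1 / Real.sqrt (1 + (Real.log K)⁻¹ * σ.cumEnt))

/-! ### FTRL regret in expectation: stability, penalty, exploration -/

section Rounds

variable {Ω 𝒳 : Type*} [mΩ : MeasurableSpace Ω] [MeasurableSpace 𝒳] {K d : ℕ}
  {I : Interaction Ω 𝒳 K d} {S : Setting 𝒳 K d} {𝒵 Θ : Set (Fin d → ℝ)} {μ : Measure Ω}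

lemma Setting.measurable_increment (S : Setting 𝒳 K d) : Measurable S.increment :=
  ((((measurable_cumEnt.const_mul _).const_add _).sqrt.const_div 1).const_mul _)

lemma Setting.Regular.measurable_entropy_q (hS : S.Regular 𝒵) {α : Type*} [MeasurableSpace α]
    (k : ℕ) {σ : α → S.Reach} {x : α → 𝒳} (hσ : Measurable σ) (hx : Measurable x) :
    Measurable fun a => entropy (S.q k (σ a).1 (x a)) := by
  have h1 : Measurable fun a => ((σ a, x a) : S.Reach × 𝒳) := hσ.prodMk hx
  have h2 := measurable_entropy.comp ((hS.measurable_q k).comp h1)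
  exact h2

namespace Interaction.IsRun

variable (hI : I.IsRun S μ 𝒵 Θ) (hS : S.Regular 𝒵) {t : ℕ}
include hI hS

omit mΩ hI in
lemma increment_nonneg (σ : State d) : 0 ≤ S.increment σ :=
  mul_nonneg hS.invRate₁_pos.le (one_div_nonneg.mpr (Real.sqrt_nonneg _))

omit mΩ hI in
lemma increment_le (t : ℕ) (ω : Ω) : S.increment (I.reach S t ω).1 ≤ S.invRate₁ :=
  mul_le_of_le_one_right hS.invRate₁_pos.le
    (hS.one_div_sqrt_le_one (hS.cumEnt_nonneg (I.obs S ω) t))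

lemma measurable_est_pow {c : Fin K → S.Reach × 𝒳 → ℝ} (hc : ∀ b, Measurable (c b)) (k : ℕ)
    (ht : t < S.T) (b : Fin K) :
    Measurable fun p : Ω × 𝒳 => c b (I.reach S t p.1, p.2) * (I.est S t p.1 ⬝ᵥ S.φ b p.2) ^ k :=
  ((hc b).comp (hI.measurable_reach_prod hS ht.le)).mul
    ((measurable_dotProduct ((hI.measurable_est hS ht).comp measurable_fst)
      ((hS.measurable_φ b).comp measurable_snd)).pow_const k)

variable [IsProbabilityMeasure μ]

lemma integrable_est_pow {c : Fin K → S.Reach × 𝒳 → ℝ} (hc : ∀ b, Measurable (c b)) {M : ℝ}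
    (hM : ∀ ω b x, |c b (I.reach S t ω, x)| ≤ M) (k : ℕ) (ht : t < S.T) (b : Fin K) :
    Integrable (fun p : Ω × 𝒳 =>
      c b (I.reach S t p.1, p.2) * (I.est S t p.1 ⬝ᵥ S.φ b p.2) ^ k) (μ.prod S.G) := by
  have := hS.prob
  have h : ∀ᵐ ω ∂μ, ∀ x, |c b (I.reach S t ω, x) * (I.est S t ω ⬝ᵥ S.φ b x) ^ k| ≤
      M * ((t + 1) * S.invRate₁) ^ k := by
    filter_upwards [hI.abs_est_le hS ht] with ω h x
    refine abs_mul_le_of_abs_le (hM ω b x) ?_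
    rw [abs_pow]
    exact pow_le_pow_left₀ (abs_nonneg _) ((h b x).trans (invRate_reach_le hS t ω)) k
  exact integrable_of_ae_abs_le (hI.measurable_est_pow hS hc k ht b) (ae_prod_of_ae_forall h)

lemma integrable_coef_linear {c : Fin K → S.Reach × 𝒳 → ℝ} (hc : ∀ b, Measurable (c b)) {M : ℝ}
    (hM : ∀ ω b x, |c b (I.reach S t ω, x)| ≤ M) (ht : t < S.T) (b : Fin K) :
    Integrable (fun p : Ω × 𝒳 =>
      c b (I.reach S t p.1, p.2) * (S.φ b p.2 ⬝ᵥ I.θ t p.1)) (μ.prod S.G) := by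
  have := hS.prob
  have h : ∀ᵐ ω ∂μ, ∀ x, |c b (I.reach S t ω, x) * (S.φ b x ⬝ᵥ I.θ t ω)| ≤ M * 1 :=
    (hI.abs_linear_le hS ht).mono fun ω h x => abs_mul_le_of_abs_le (hM ω b x) (h b x)
  exact integrable_of_ae_abs_le (((hc b).comp (hI.measurable_reach_prod hS ht.le)).mul
    (hI.measurable_linear hS measurable_const ht)) (ae_prod_of_ae_forall h)

/-- Fubini puts the context outside; for a fixed context the coefficients depend on the state only
and unbiasedness applies. -/
lemma integral_sum_est {c : Fin K → S.Reach × 𝒳 → ℝ} (hc : ∀ b, Measurable (c b)) {M : ℝ}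
    (hM : ∀ ω b x, |c b (I.reach S t ω, x)| ≤ M) (ht : t < S.T) :
    ∫ p, ∑ b, c b (I.reach S t p.1, p.2) * (I.est S t p.1 ⬝ᵥ S.φ b p.2) ^ 1 ∂(μ.prod S.G) =
      ∫ p, ∑ b, c b (I.reach S t p.1, p.2) * (S.φ b p.2 ⬝ᵥ I.θ t p.1) ∂(μ.prod S.G) := by
  have := hS.prob
  have h1 := hI.integrable_est_pow hS hc hM 1 ht
  have h2 := hI.integrable_coef_linear hS hc hM ht
  rw [integral_finsetSum _ fun b _ => h1 b, integral_finsetSum _ fun b _ => h2 b]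
  refine Finset.sum_congr rfl fun b _ => ?_
  rw [integral_prod_symm _ (h1 b), integral_prod_symm _ (h2 b)]
  congr 1 with x
  simp only [pow_one]
  exact hI.integral_est hS ht (c := fun σ => c b (σ, x))
    ((hc b).comp (measurable_id.prodMk measurable_const)) (fun ω => hM ω b x) b x

omit hI in
lemma measurable_inv_rate_mul_q (t : ℕ) (b : Fin K) :
    Measurable fun p : S.Reach × 𝒳 => 1 / p.1.1.invRate * S.q t p.1.1 p.2 b :=
  ((measurable_invRate.comp (measurable_subtype_coe.comp measurable_fst)).const_div 1).mul
    ((measurable_pi_apply b).comp (hS.measurable_q t))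

omit mΩ hI [IsProbabilityMeasure μ] in
lemma abs_inv_rate_mul_q_le (t : ℕ) (σ : S.Reach) (b : Fin K) (x : 𝒳) :
    |1 / σ.1.invRate * S.q t σ.1 x b| ≤ 1 / S.invRate₁ * 1 := by
  have h := hS.q_mem t σ x
  refine abs_mul_le_of_abs_le ?_ ?_
  · rw [abs_of_nonneg (one_div_nonneg.mpr (hS.invRate_pos σ).le)]
    exact one_div_le_one_div_of_le hS.invRate₁_pos σ.2
  · rw [abs_of_nonneg (h.1 b)]
    exact le_one_of_mem_stdSimplex h b

lemma integrable_inv_rate (ht : t ≤ S.T) :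
    Integrable (fun ω => 1 / (I.reach S t ω).1.invRate) μ := by
  refine integrable_of_ae_abs_le (((measurable_invRate.comp measurable_subtype_coe).comp
    (hI.measurable_reach hS ht)).const_div 1) (M := 1 / S.invRate₁) (.of_forall fun ω => ?_)
  rw [abs_of_nonneg (one_div_nonneg.mpr (hS.invRate_pos _).le)]
  exact one_div_le_one_div_of_le hS.invRate₁_pos (I.reach S t ω).2

/-- The stability term of a round. -/
lemma integral_stability_le (ht : t < S.T) :
    ∫ p, ∑ b, (1 / (I.reach S t p.1).1.invRate * S.q t (I.reach S t p.1).1 p.2 b) *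
      (I.est S t p.1 ⬝ᵥ S.φ b p.2) ^ 2 ∂(μ.prod S.G) ≤
      2 * (1 / S.lam + d) * ∫ ω, 1 / (I.reach S t ω).1.invRate ∂μ := by
  have := hS.prob
  have hc := measurable_inv_rate_mul_q hS t
  have hM : ∀ ω b x, |1 / (I.reach S t ω).1.invRate * S.q t (I.reach S t ω).1 x b| ≤
      1 / S.invRate₁ * 1 := fun ω b x => abs_inv_rate_mul_q_le hS t _ b x
  have h1 := hI.integrable_est_pow hS
    (c := fun b p => 1 / p.1.1.invRate * S.q t p.1.1 p.2 b) hc hM 2 ht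
  have h2 : ∀ b, Integrable (fun p : Ω × 𝒳 =>
      1 / (I.reach S t p.1).1.invRate * S.q t (I.reach S t p.1).1 p.2 b *
      (S.φ b p.2 ⬝ᵥ ((S.covariance (S.policy t (I.reach S t p.1).1))⁻¹ *ᵥ S.φ b p.2)))
      (μ.prod S.G) := fun b => by
    refine integrable_of_ae_abs_le (M := 1 / S.invRate₁ * 1 * ((t + 1) * S.invRate₁)) ?_
      (.of_forall fun p => abs_mul_le_of_abs_le (hM p.1 b p.2)
        ((hS.abs_form_le t _ b b _ _).trans (invRate_reach_le hS t p.1)))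
    have hφ : Measurable fun p : Ω × 𝒳 => S.φ b p.2 := (hS.measurable_φ b).comp measurable_snd
    exact ((hc b).comp (hI.measurable_reach_prod hS ht.le)).mul (measurable_dotProduct hφ
      (hS.measurable_inv_mulVec t ((hI.measurable_reach hS ht.le).comp measurable_fst) hφ))
  calc _ ≤ ∫ p, ∑ b, (1 / (I.reach S t p.1).1.invRate * S.q t (I.reach S t p.1).1 p.2 b *
      (S.φ b p.2 ⬝ᵥ ((S.covariance (S.policy t (I.reach S t p.1).1))⁻¹ *ᵥ S.φ b p.2)))
      ∂(μ.prod S.G) := by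
        rw [integral_finsetSum _ fun b _ => h1 b, integral_finsetSum _ fun b _ => h2 b]
        refine Finset.sum_le_sum fun b _ => ?_
        rw [integral_prod_symm _ (h1 b), integral_prod_symm _ (h2 b)]
        refine integral_mono (h1 b).integral_prod_right (h2 b).integral_prod_right fun x => ?_
        -- The fresh context x is frozen here, so η_t q_t(b | x) is a nonnegative weight determined
        -- by the state.
        exact hI.integral_est_sq_le hS ht
          (c := fun σ => 1 / σ.1.invRate * S.q t σ.1 x b)
          ((hc b).comp (measurable_id.prodMk measurable_const)) (fun ω => hM ω b x)
          (fun σ => mul_nonneg (one_div_nonneg.mpr (hS.invRate_pos σ).le)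
            ((hS.q_mem t σ x).1 b)) b x
    _ ≤ _ := by
        rw [integral_prod _ (integrable_finsetSum _ fun b _ => h2 b), ← integral_const_mul]
        refine integral_mono (integrable_finsetSum _ fun b _ => h2 b).integral_prod_left
          ((hI.integrable_inv_rate hS ht.le).const_mul _) fun ω => ?_
        simp only [mul_assoc, ← Finset.mul_sum]
        rw [integral_const_mul, mul_comm]
        refine (mul_le_mul_of_nonneg_right (hS.integral_q_form_le t (I.reach S t ω))
          (one_div_nonneg.mpr (hS.invRate_pos _).le)).trans_eq (by ring)

omit mΩ hI hS [IsProbabilityMeasure μ] in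
lemma cumEst_reach_zero (ω : Ω) : (I.reach S 0 ω).1.cumEst = 0 := rfl

omit mΩ hI hS [IsProbabilityMeasure μ] in
lemma invRate_reach_zero (ω : Ω) : (I.reach S 0 ω).1.invRate = S.invRate₁ := rfl

omit mΩ hI hS [IsProbabilityMeasure μ] in
lemma cumEst_reach_succ (t : ℕ) (ω : Ω) : (I.reach S (t + 1) ω).1.cumEst =
    (I.reach S t ω).1.cumEst + I.est S t ω := rfl

omit mΩ hI hS [IsProbabilityMeasure μ] in
lemma invRate_reach_succ (t : ℕ) (ω : Ω) : (I.reach S (t + 1) ω).1.invRate =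
    (I.reach S t ω).1.invRate + S.increment (I.reach S (t + 1) ω).1 := rfl

omit mΩ hI [IsProbabilityMeasure μ] in
-- In the first round no loss has accumulated and the Gibbs distribution is uniform, so the separate
-- definition of the first round is no exception.
lemma q_reach_eq_gibbs (t : ℕ) (ω : Ω) (x : 𝒳) : S.q t (I.reach S t ω).1 x =
    gibbs (fun a => (I.reach S t ω).1.cumEst ⬝ᵥ S.φ a x) (I.reach S t ω).1.invRate := by
  rcases eq_or_ne t 0 with rfl | ht
  · have : (fun a => (I.reach S 0 ω).1.cumEst ⬝ᵥ S.φ a x) = 0 := by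
      funext a
      exact zero_dotProduct _
    rw [this, gibbs_zero]
    rfl
  · exact hS.q_eq_gibbs ht _ x

omit [IsProbabilityMeasure μ] in
-- The exceptional null set does not depend on x: the bound on the observed losses controls the
-- estimates at all contexts at once.
lemma ae_ftrl_regret (ρ : 𝒳 → Fin K) : ∀ᵐ ω ∂μ, ∀ x,
    ∑ t ∈ Finset.range S.T, ((∑ b, S.q t (I.reach S t ω).1 x b * (I.est S t ω ⬝ᵥ S.φ b x)) -
      I.est S t ω ⬝ᵥ S.φ (ρ x) x) ≤
    S.invRate₁ * Real.log K + ∑ t ∈ Finset.range S.T, S.increment (I.reach S (t + 1) ω).1 *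
      entropy (S.q (t + 1) (I.reach S (t + 1) ω).1 x) +
    ∑ t ∈ Finset.range S.T, ∑ b, (1 / (I.reach S t ω).1.invRate *
      S.q t (I.reach S t ω).1 x b) * (I.est S t ω ⬝ᵥ S.φ b x) ^ 2 := by
  have hall : ∀ᵐ ω ∂μ, ∀ t < S.T, ∀ b x,
      |I.est S t ω ⬝ᵥ S.φ b x| ≤ (I.reach S t ω).1.invRate :=
    ae_all_iff.mpr fun t => Filter.eventually_imp_distrib_left.mpr fun ht => hI.abs_est_le hS ht
  filter_upwards [hall] with ω h x
  have := hS.neZero_arms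
  have hf := ftrl_regret (L := fun t a => (I.reach S t ω).1.cumEst ⬝ᵥ S.φ a x)
    (ℓ := fun t a => I.est S t ω ⬝ᵥ S.φ a x) (β := fun t => (I.reach S t ω).1.invRate) S.T
    (funext fun a => by simp only [cumEst_reach_zero, zero_dotProduct, Pi.zero_apply])
    (fun t _ => funext fun a => by simp only [cumEst_reach_succ, add_dotProduct, Pi.add_apply])
    (fun t => hS.invRate_pos _) (fun t ht a => h t ht a x) (ρ x)
  simp only [← q_reach_eq_gibbs hS] at hf
  simp only [invRate_reach_succ, add_sub_cancel_left, invRate_reach_zero] at hf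
  simp only [mul_assoc, ← Finset.mul_sum]
  exact hf

lemma integrable_increment_mul_entropy (k : ℕ) {s : ℕ} (hs : s ≤ S.T) :
    Integrable (fun p : Ω × 𝒳 => S.increment (I.reach S s p.1).1 *
      entropy (S.q k (I.reach S s p.1).1 p.2)) (μ.prod S.G) := by
  have := hS.prob
  have := hS.neZero_arms
  refine integrable_of_ae_abs_le ?_ (M := S.invRate₁ * Real.log K) (.of_forall fun p => ?_)
  · have h1 : Measurable fun p : Ω × 𝒳 => I.reach S s p.1 :=
      (hI.measurable_reach hS hs).comp measurable_fst
    exact (S.measurable_increment.comp (measurable_subtype_coe.comp h1)).mul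
      (hS.measurable_entropy_q k h1 measurable_snd)
  · refine abs_mul_le_of_abs_le ?_ ?_
    · rw [abs_of_nonneg (increment_nonneg hS _)]
      exact increment_le hS s p.1
    · rw [abs_of_nonneg (entropy_nonneg (hS.q_mem k _ _))]
      exact entropy_le_log (hS.q_mem k _ _)

/-- The regret of the FTRL distributions against a comparator, in expectation. -/
lemma sum_integral_q_sub_le {ρ : 𝒳 → Fin K} (hρ : Measurable ρ) :
    ∑ t ∈ Finset.range S.T, ((∫ p, ∑ a, S.q t (I.reach S t p.1).1 p.2 a *
        (S.φ a p.2 ⬝ᵥ I.θ t p.1) ∂(μ.prod S.G)) -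
        ∫ p, S.φ (ρ p.2) p.2 ⬝ᵥ I.θ t p.1 ∂(μ.prod S.G)) ≤
      S.invRate₁ * Real.log K + ∑ t ∈ Finset.range S.T,
        (∫ p, S.increment (I.reach S (t + 1) p.1).1 *
          entropy (S.q (t + 1) (I.reach S (t + 1) p.1).1 p.2) ∂(μ.prod S.G)) +
      ∑ t ∈ Finset.range S.T,
        2 * (1 / S.lam + d) * ∫ ω, 1 / (I.reach S t ω).1.invRate ∂μ := by
  have := hS.prob
  -- Signed weights, learner minus comparator: the regret of a round is one weighted sum over arms,
  -- and unbiasedness is applied to both sides at once.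
  let c : ℕ → Fin K → S.Reach × 𝒳 → ℝ := fun t b p =>
    S.q t p.1.1 p.2 b - Set.indicator {x | ρ x = b} (fun _ => (1 : ℝ)) p.2
  have hc : ∀ t b, Measurable (c t b) := fun t b =>
    ((measurable_pi_apply b).comp (hS.measurable_q t)).sub
      ((measurable_const.indicator (hρ (measurableSet_singleton b))).comp measurable_snd)
  have hM : ∀ t ω b x, |c t b (I.reach S t ω, x)| ≤ 1 := fun t ω b x => by
    have h0 := (hS.q_mem t (I.reach S t ω) x).1 b
    have h1 := le_one_of_mem_stdSimplex (hS.q_mem t (I.reach S t ω) x) b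
    simp only [c]
    by_cases h : x ∈ {x | ρ x = b}
    · rw [Set.indicator_of_mem h, abs_le]; constructor <;> linarith
    · rw [Set.indicator_of_notMem h, abs_le]; constructor <;> linarith
  have hsum : ∀ t σ x (f : Fin K → ℝ),
      ∑ b, c t b (σ, x) * f b = (∑ b, S.q t σ.1 x b * f b) - f (ρ x) := fun t σ x f => by
    simp only [c, sub_mul, Finset.sum_sub_distrib]
    congr 1
    rw [Finset.sum_eq_single (ρ x)]
    · have h : x ∈ {y | ρ y = ρ x} := rfl
      rw [Set.indicator_of_mem h, one_mul]
    · intro a _ ha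
      have h : x ∉ {y | ρ y = a} := fun h => ha h.symm
      rw [Set.indicator_of_notMem h, zero_mul]
    · simp
  have hD : ∀ t ∈ Finset.range S.T, Integrable (fun p : Ω × 𝒳 =>
      ∑ b, c t b (I.reach S t p.1, p.2) * (I.est S t p.1 ⬝ᵥ S.φ b p.2) ^ 1) (μ.prod S.G) :=
    fun t ht => integrable_finsetSum _ fun b _ =>
      hI.integrable_est_pow hS (hc t) (hM t) 1 (Finset.mem_range.mp ht) b
  have hE : ∀ t ∈ Finset.range S.T, Integrable (fun p : Ω × 𝒳 =>
      S.increment (I.reach S (t + 1) p.1).1 *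
        entropy (S.q (t + 1) (I.reach S (t + 1) p.1).1 p.2)) (μ.prod S.G) := fun t ht =>
    hI.integrable_increment_mul_entropy hS (t + 1) (Finset.mem_range.mp ht)
  have hV : ∀ t ∈ Finset.range S.T, Integrable (fun p : Ω × 𝒳 =>
      ∑ b, (1 / (I.reach S t p.1).1.invRate * S.q t (I.reach S t p.1).1 p.2 b) *
        (I.est S t p.1 ⬝ᵥ S.φ b p.2) ^ 2) (μ.prod S.G) := fun t ht =>
    integrable_finsetSum _ fun b _ => hI.integrable_est_pow hS
      (c := fun b p => 1 / p.1.1.invRate * S.q t p.1.1 p.2 b) (measurable_inv_rate_mul_q hS t)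
      (fun ω b x => abs_inv_rate_mul_q_le hS t _ b x) 2 (Finset.mem_range.mp ht) b
  have hlhs : ∑ t ∈ Finset.range S.T, ((∫ p, ∑ a, S.q t (I.reach S t p.1).1 p.2 a *
        (S.φ a p.2 ⬝ᵥ I.θ t p.1) ∂(μ.prod S.G)) -
        ∫ p, S.φ (ρ p.2) p.2 ⬝ᵥ I.θ t p.1 ∂(μ.prod S.G)) =
      ∫ p, ∑ t ∈ Finset.range S.T,
        ∑ b, c t b (I.reach S t p.1, p.2) * (I.est S t p.1 ⬝ᵥ S.φ b p.2) ^ 1 ∂(μ.prod S.G) := by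
    rw [integral_finsetSum _ hD]
    refine Finset.sum_congr rfl fun t ht => ?_
    have ht' := Finset.mem_range.mp ht
    rw [hI.integral_sum_est hS (hc t) (hM t) ht']
    simp only [hsum]
    rw [integral_sub (hI.integrable_policy_linear hS (p := fun z => S.q t z.1.1 z.2)
      (hS.measurable_q t) (fun z => hS.q_mem t z.1 z.2) ht') (hI.integrable_linear hS hρ ht')]
  rw [hlhs]
  have hmono : ∫ p, ∑ t ∈ Finset.range S.T,
        ∑ b, c t b (I.reach S t p.1, p.2) * (I.est S t p.1 ⬝ᵥ S.φ b p.2) ^ 1 ∂(μ.prod S.G) ≤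
      ∫ p, (S.invRate₁ * Real.log K + ∑ t ∈ Finset.range S.T,
        S.increment (I.reach S (t + 1) p.1).1 *
          entropy (S.q (t + 1) (I.reach S (t + 1) p.1).1 p.2) +
        ∑ t ∈ Finset.range S.T, ∑ b, (1 / (I.reach S t p.1).1.invRate *
          S.q t (I.reach S t p.1).1 p.2 b) * (I.est S t p.1 ⬝ᵥ S.φ b p.2) ^ 2)
        ∂(μ.prod S.G) := by
    refine integral_mono_ae (integrable_finsetSum _ hD)
      (((integrable_const _).add (integrable_finsetSum _ hE)).add (integrable_finsetSum _ hV)) ?_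
    have := ae_prod_of_ae_forall (κ := S.G) (hI.ae_ftrl_regret hS ρ)
    filter_upwards [this] with p hp
    simp only [hsum, pow_one]
    exact hp
  have hCE : Integrable (fun p : Ω × 𝒳 => S.invRate₁ * Real.log K + ∑ t ∈ Finset.range S.T,
      S.increment (I.reach S (t + 1) p.1).1 *
        entropy (S.q (t + 1) (I.reach S (t + 1) p.1).1 p.2)) (μ.prod S.G) :=
    (integrable_const _).add (integrable_finsetSum _ hE)
  refine hmono.trans ?_
  rw [integral_add hCE (integrable_finsetSum _ hV), integral_add (integrable_const _) (integrable_finsetSum _ hE),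
    integral_const, probReal_univ, one_smul, integral_finsetSum _ hE, integral_finsetSum _ hV]
  gcongr with t ht
  exact hI.integral_stability_le hS (Finset.mem_range.mp ht)

/-- The cost of exploration in a round. -/
lemma integral_policy_le (ht : t < S.T) :
    ∫ p, ∑ a, S.policy t (I.reach S t p.1).1 p.2 a * (S.φ a p.2 ⬝ᵥ I.θ t p.1) ∂(μ.prod S.G) ≤
      (∫ p, ∑ a, S.q t (I.reach S t p.1).1 p.2 a * (S.φ a p.2 ⬝ᵥ I.θ t p.1) ∂(μ.prod S.G)) +
      2 * (1 / S.lam) * ∫ ω, 1 / (I.reach S t ω).1.invRate ∂μ := by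
  have := hS.prob
  have h1 := hI.integrable_policy_linear hS (p := fun z => S.policy t z.1.1 z.2)
    (hS.measurable_policy t) (fun z => hS.policy_mem t z.1 z.2) ht
  have h2 := hI.integrable_policy_linear hS (p := fun z => S.q t z.1.1 z.2)
    (hS.measurable_q t) (fun z => hS.q_mem t z.1 z.2) ht
  have h3 : Integrable (fun p : Ω × 𝒳 =>
      2 * (1 / S.lam) * (1 / (I.reach S t p.1).1.invRate)) (μ.prod S.G) :=
    ((hI.integrable_inv_rate hS ht.le).comp_fst S.G).const_mul _
  have h4 : ∫ p, 2 * (1 / S.lam) * (1 / (I.reach S t p.1).1.invRate) ∂(μ.prod S.G) =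
      2 * (1 / S.lam) * ∫ ω, 1 / (I.reach S t ω).1.invRate ∂μ := by
    rw [integral_prod _ h3, ← integral_const_mul]
    simp
  rw [← h4, ← integral_add h2 h3]
  refine integral_mono_ae h1 (h2.add h3) ?_
  have := ae_prod_of_ae_forall (κ := S.G) ((hI.abs_linear_le hS ht).mono
    fun ω (h : ∀ a x, |S.φ a x ⬝ᵥ I.θ t ω| ≤ 1) x a => h a x)
  filter_upwards [this] with p hp
  -- The policies differ by γ (e* - q), and both mean losses lie in [-1, 1]; hence the cost 2γ.
  have hq := (abs_le.mp (abs_sum_mul_le (hS.q_mem t (I.reach S t p.1) p.2) hp)).1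
  have he := (abs_le.mp (abs_sum_mul_le (hS.explo_mem p.2) hp)).2
  have hγ := hS.mixing_pos (I.reach S t p.1)
  have hsplit : ∑ a, S.policy t (I.reach S t p.1).1 p.2 a * (S.φ a p.2 ⬝ᵥ I.θ t p.1) =
      (1 - S.mixing (I.reach S t p.1).1) *
        (∑ a, S.q t (I.reach S t p.1).1 p.2 a * (S.φ a p.2 ⬝ᵥ I.θ t p.1)) +
      S.mixing (I.reach S t p.1).1 * ∑ a, S.explo p.2 a * (S.φ a p.2 ⬝ᵥ I.θ t p.1) := by
    rw [Finset.mul_sum, Finset.mul_sum, ← Finset.sum_add_distrib]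
    refine Finset.sum_congr rfl fun a _ => ?_
    rw [Setting.policy]
    ring
  have hmix : 2 * (1 / S.lam) * (1 / (I.reach S t p.1).1.invRate) =
      2 * S.mixing (I.reach S t p.1).1 := by
    rw [Setting.mixing]; ring
  rw [hsplit, hmix]
  nlinarith

/-- Converts the fresh-context entropy in the penalty into the realized entropy that drives the
learning rate. It needs a round with a context, hence t < T, and a weight that depends on the state
only. -/
lemma integral_entropy_context (k : ℕ) {c : S.Reach → ℝ} (hc : Measurable c) (ht : t < S.T) :
    ∫ p, c (I.reach S t p.1) * entropy (S.q k (I.reach S t p.1).1 p.2) ∂(μ.prod S.G) =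
      ∫ ω, c (I.reach S t ω) * entropy (S.q k (I.reach S t ω).1 (I.X t ω)) ∂μ := by
  have h1 : Measurable fun p : (S.Reach × (Fin d → ℝ)) × 𝒳 => p.1.1 :=
    measurable_fst.comp measurable_fst
  symm
  refine hI.integral_context hS ht (g := fun p => c p.1.1 * entropy (S.q k p.1.1.1 p.2)) ?_
  exact (hc.comp h1).mul (hS.measurable_entropy_q k h1 measurable_snd)

end Interaction.IsRun

end Rounds

/-! ### From accumulated entropy to the regret bound -/

section Rounds

variable {Ω 𝒳 : Type*} [mΩ : MeasurableSpace Ω] [MeasurableSpace 𝒳] {K d : ℕ}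
  {I : Interaction Ω 𝒳 K d} {S : Setting 𝒳 K d} {𝒵 Θ : Set (Fin d → ℝ)} {μ : Measure Ω}

/-- The entropy of the FTRL distribution at the context of the round. -/
def Interaction.ent (I : Interaction Ω 𝒳 K d) (S : Setting 𝒳 K d) (t : ℕ) (ω : Ω) : ℝ :=
  entropy (S.q t (I.reach S t ω).1 (I.X t ω))

namespace Interaction

omit mΩ in
lemma cumEnt_reach (t : ℕ) (ω : Ω) :
    (I.reach S t ω).1.cumEnt = ∑ s ∈ Finset.range t, I.ent S s ω :=
  S.cumEnt_state _ _

omit mΩ in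
lemma ent_zero (ω : Ω) : I.ent S 0 ω = Real.log K := entropy_uniform

omit mΩ in
lemma ent_nonneg (hS : S.Regular 𝒵) (t : ℕ) (ω : Ω) : 0 ≤ I.ent S t ω :=
  entropy_nonneg (hS.q_mem _ _ _)

omit mΩ in
lemma ent_le_log (hS : S.Regular 𝒵) (t : ℕ) (ω : Ω) : I.ent S t ω ≤ Real.log K := by
  have := hS.neZero_arms
  exact entropy_le_log (hS.q_mem _ _ _)

omit mΩ in
lemma increment_reach (t : ℕ) (ω : Ω) : S.increment (I.reach S t ω).1 = S.invRate₁ *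
    (1 / Real.sqrt (1 + (Real.log K)⁻¹ * ∑ s ∈ Finset.range t, I.ent S s ω)) := by
  rw [Setting.increment, cumEnt_reach]

omit mΩ in
lemma log_arms_le_cumEnt (hS : S.Regular 𝒵) (ω : Ω) :
    Real.log K ≤ (I.reach S S.T ω).1.cumEnt := by
  rw [cumEnt_reach, ← ent_zero (I := I) (S := S) ω]
  exact Finset.single_le_sum (f := fun t => I.ent S t ω) (fun t _ => ent_nonneg hS t ω)
    (Finset.mem_range.mpr (by have := hS.two_le_rounds; omega))

omit mΩ in
lemma sum_inv_rate_reach_le (hS : S.Regular 𝒵) (ω : Ω) :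
    ∑ t ∈ Finset.range S.T, 1 / (I.reach S t ω).1.invRate ≤
      1 / S.invRate₁ * (2 * (Real.sqrt (I.reach S S.T ω).1.cumEnt / Real.sqrt (Real.log K))) *
        (1 + Real.log S.T) := by
  rw [cumEnt_reach]
  have hT := hS.two_le_rounds
  refine sum_inv_rate_le (h := fun t => I.ent S t ω) (β := fun t => (I.reach S t ω).1.invRate)
    hS.log_arms_pos (ent_zero ω) (fun t _ => ent_nonneg hS t ω) (by omega) hS.invRate₁_pos
    fun t _ => ?_
  have h := increment_reach (I := I) (S := S) (t + 1) ω
  rw [IsRun.invRate_reach_succ, h]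
  rfl

omit mΩ in
lemma sum_increment_mul_ent_le (hS : S.Regular 𝒵) {n : ℕ} (hn : S.T = n + 1) (ω : Ω) :
    ∑ t ∈ Finset.range n, S.increment (I.reach S (t + 1) ω).1 * I.ent S (t + 1) ω ≤
      S.invRate₁ * (2 * (Real.sqrt (Real.log K) * Real.sqrt (I.reach S S.T ω).1.cumEnt)) := by
  have h := sum_rate_mul_le (h := fun t => I.ent S t ω) (n := n) hS.log_arms_pos (ent_zero ω)
    (fun t _ => ent_nonneg hS t ω) (fun t _ => ent_le_log hS t ω)
  rw [cumEnt_reach, hn]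
  refine le_trans (le_of_eq ?_) (mul_le_mul_of_nonneg_left h hS.invRate₁_pos.le)
  rw [Finset.mul_sum]
  exact Finset.sum_congr rfl fun t _ => by rw [increment_reach, mul_assoc]

namespace IsRun

variable (hI : I.IsRun S μ 𝒵 Θ) (hS : S.Regular 𝒵) {t : ℕ}
include hI hS

lemma measurable_ent (ht : t < S.T) : Measurable (I.ent S t) :=
  hS.measurable_entropy_q t (hI.measurable_reach hS ht.le) (hI.measurable_X t ht)

variable [IsProbabilityMeasure μ]

lemma integrable_ent (ht : t < S.T) : Integrable (I.ent S t) μ :=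
  integrable_of_ae_abs_le (hI.measurable_ent hS ht) (M := Real.log K) (.of_forall fun ω => by
    rw [abs_of_nonneg (ent_nonneg hS t ω)]
    exact ent_le_log hS t ω)

lemma integrable_cumEnt : Integrable (fun ω => (I.reach S S.T ω).1.cumEnt) μ := by
  simp only [cumEnt_reach]
  exact integrable_finsetSum _ fun t ht => hI.integrable_ent hS (Finset.mem_range.mp ht)

lemma integrable_sqrt_cumEnt :
    Integrable (fun ω => Real.sqrt (I.reach S S.T ω).1.cumEnt) μ := by
  refine ((hI.integrable_cumEnt hS).add (integrable_const 1)).mono'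
    ((measurable_cumEnt.comp (measurable_subtype_coe.comp
      (hI.measurable_reach hS le_rfl))).sqrt.aestronglyMeasurable) (.of_forall fun ω => ?_)
  have h := hS.log_arms_pos.le.trans (log_arms_le_cumEnt (I := I) hS ω)
  rw [Real.norm_eq_abs, abs_of_nonneg (Real.sqrt_nonneg _)]
  simp only [Pi.add_apply]
  nlinarith [Real.sq_sqrt h, sq_nonneg (Real.sqrt (I.reach S S.T ω).1.cumEnt - 1),
    Real.sqrt_nonneg (I.reach S S.T ω).1.cumEnt]

lemma integral_entropy_eq (ht : t < S.T) :
    ∫ p, entropy (S.q t (I.reach S t p.1).1 p.2) ∂(μ.prod S.G) = ∫ ω, I.ent S t ω ∂μ := by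
  have h := hI.integral_entropy_context hS t (c := fun _ => 1) measurable_const ht
  simp only [one_mul] at h
  exact h

/-- Realized and fresh contexts give the same mean entropy, and for a fresh context the entropy is
bounded by the mass off ρ(x). The errors 1/T add up to one. -/
lemma integral_cumEnt_le {ρ : 𝒳 → Fin K} (hρ : Measurable ρ) :
    ∫ ω, (I.reach S S.T ω).1.cumEnt ∂μ ≤ I.Qbar S μ ρ * (1 + Real.log (K * S.T)) + 1 := by
  have := hS.prob
  have := hS.neZero_arms
  have hT : (0 : ℝ) < S.T := by have := hS.two_le_rounds; positivity
  have hq : ∀ t ∈ Finset.range S.T, Integrable (fun p : Ω × 𝒳 =>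
      1 - S.q t (I.reach S t p.1).1 p.2 (ρ p.2)) (μ.prod S.G) := fun t ht => by
    have hpair : Measurable fun x : Fin K × (Fin K → ℝ) => x.2 x.1 :=
      measurable_from_prod_countable_right fun a => measurable_pi_apply a
    have h1 := (hS.measurable_q t).comp
      (hI.measurable_reach_prod hS (Finset.mem_range.mp ht).le)
    refine integrable_of_ae_abs_le
      ((hpair.comp ((hρ.comp measurable_snd).prodMk h1)).const_sub 1) (M := 1)
      (.of_forall fun p => ?_)
    have h0 := (hS.q_mem t (I.reach S t p.1) p.2).1 (ρ p.2)
    have h1 := le_one_of_mem_stdSimplex (hS.q_mem t (I.reach S t p.1) p.2) (ρ p.2)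
    rw [abs_le]
    constructor <;> linarith
  have hent : ∀ t ∈ Finset.range S.T, Integrable (fun p : Ω × 𝒳 =>
      entropy (S.q t (I.reach S t p.1).1 p.2)) (μ.prod S.G) := fun t ht => by
    refine integrable_of_ae_abs_le (hS.measurable_entropy_q t ((hI.measurable_reach hS
      (Finset.mem_range.mp ht).le).comp measurable_fst) measurable_snd) (M := Real.log K)
      (.of_forall fun p => ?_)
    rw [abs_of_nonneg (entropy_nonneg (hS.q_mem _ _ _))]
    exact entropy_le_log (hS.q_mem _ _ _)
  have hQ : I.Qbar S μ ρ = ∫ p, ∑ t ∈ Finset.range S.T,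
      (1 - S.q t (I.reach S t p.1).1 p.2 (ρ p.2)) ∂(μ.prod S.G) :=
    (integral_prod _ (integrable_finsetSum _ hq)).symm
  have hbound : Integrable (fun p : Ω × 𝒳 => (∑ t ∈ Finset.range S.T,
      (1 - S.q t (I.reach S t p.1).1 p.2 (ρ p.2))) * (1 + Real.log (K * S.T)))
      (μ.prod S.G) := (integrable_finsetSum _ hq).mul_const _
  simp only [cumEnt_reach]
  rw [integral_finsetSum _ fun t ht => hI.integrable_ent hS (Finset.mem_range.mp ht),
    ← Finset.sum_congr rfl fun t ht => hI.integral_entropy_eq hS (Finset.mem_range.mp ht),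
    ← integral_finsetSum _ hent, hQ, ← integral_mul_const]
  have hone : ∫ _, (1 : ℝ) ∂(μ.prod S.G) = 1 := by simp
  calc _ ≤ ∫ p, ((∑ t ∈ Finset.range S.T,
      (1 - S.q t (I.reach S t p.1).1 p.2 (ρ p.2))) * (1 + Real.log (K * S.T)) + 1)
      ∂(μ.prod S.G) := by
        refine integral_mono (integrable_finsetSum _ hent) (hbound.add (integrable_const 1))
          fun p => ?_
        calc _ ≤ ∑ t ∈ Finset.range S.T, ((1 - S.q t (I.reach S t p.1).1 p.2 (ρ p.2)) *
              (1 + Real.log (K * S.T)) + 1 / S.T) := Finset.sum_le_sum fun t _ =>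
                entropy_le_one_sub_mul (hS.q_mem _ _ _) (ρ p.2) hT
          _ = _ := by
              rw [Finset.sum_add_distrib, ← Finset.sum_mul, Finset.sum_const, Finset.card_range,
                nsmul_eq_mul, mul_one_div_cancel hT.ne']
    _ = _ := by rw [integral_add hbound (integrable_const _), hone]

/-- A bound on the regret in terms of the accumulated entropy. -/
lemma sum_regret_le {ρ : 𝒳 → Fin K} (hρ : Measurable ρ) :
    ∑ t ∈ Finset.range S.T, ((∫ p, ∑ a, S.policy t (I.reach S t p.1).1 p.2 a *
        (S.φ a p.2 ⬝ᵥ I.θ t p.1) ∂(μ.prod S.G)) -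
        ∫ p, S.φ (ρ p.2) p.2 ⬝ᵥ I.θ t p.1 ∂(μ.prod S.G)) ≤
      2 * (S.invRate₁ * Real.log K) +
      (2 * (S.invRate₁ * Real.sqrt (Real.log K)) +
        8 * (S.rate₁ * (1 / S.lam + d) * ((1 + Real.log S.T) / Real.sqrt (Real.log K)))) *
        ∫ ω, Real.sqrt (I.reach S S.T ω).1.cumEnt ∂μ := by
  have := hS.prob
  have := hS.neZero_arms
  -- The penalty sum ends with index T, the state after the last round, where the run supplies no
  -- context to exchange. That term is split off and bounded crudely by (1/η_1) log K.
  obtain ⟨n, hn⟩ : ∃ n, S.T = n + 1 := ⟨S.T - 1, by have := hS.two_le_rounds; omega⟩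
  have hlam : 0 < 1 / S.lam := one_div_pos.mpr hS.lam_pos
  have hd : (0 : ℝ) ≤ d := Nat.cast_nonneg d
  have hrate : ∀ t ∈ Finset.range S.T,
      Integrable (fun ω => 1 / (I.reach S t ω).1.invRate) μ := fun t ht =>
    hI.integrable_inv_rate hS (Finset.mem_range.mp ht).le
  have hsqrt := hI.integrable_sqrt_cumEnt hS
  have hsum_rate : ∑ t ∈ Finset.range S.T, ∫ ω, 1 / (I.reach S t ω).1.invRate ∂μ ≤
      1 / S.invRate₁ * (2 / Real.sqrt (Real.log K)) * (1 + Real.log S.T) *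
        ∫ ω, Real.sqrt (I.reach S S.T ω).1.cumEnt ∂μ := by
    rw [← integral_finsetSum _ hrate, ← integral_const_mul]
    refine integral_mono (integrable_finsetSum _ hrate) (hsqrt.const_mul _) fun ω => ?_
    exact (sum_inv_rate_reach_le hS ω).trans_eq (by ring)
  have hinc : ∀ t < n, ∫ p, S.increment (I.reach S (t + 1) p.1).1 *
        entropy (S.q (t + 1) (I.reach S (t + 1) p.1).1 p.2) ∂(μ.prod S.G) =
      ∫ ω, S.increment (I.reach S (t + 1) ω).1 * I.ent S (t + 1) ω ∂μ := fun t ht =>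
    hI.integral_entropy_context hS (t + 1) (c := fun σ => S.increment σ.1)
      (S.measurable_increment.comp measurable_subtype_coe) (by omega)
  have hinci : ∀ t ∈ Finset.range n, Integrable (fun ω =>
      S.increment (I.reach S (t + 1) ω).1 * I.ent S (t + 1) ω) μ := fun t ht => by
    have ht' : t + 1 < S.T := by have := Finset.mem_range.mp ht; omega
    refine integrable_of_ae_abs_le ((S.measurable_increment.comp (measurable_subtype_coe.comp
      (hI.measurable_reach hS ht'.le))).mul (hI.measurable_ent hS ht'))
      (M := S.invRate₁ * Real.log K) (.of_forall fun ω => abs_mul_le_of_abs_le ?_ ?_)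
    · rw [abs_of_nonneg (increment_nonneg hS _)]
      exact increment_le hS _ ω
    · rw [abs_of_nonneg (ent_nonneg hS _ ω)]
      exact ent_le_log hS _ ω
  have hlast : ∫ p, S.increment (I.reach S (n + 1) p.1).1 *
      entropy (S.q (n + 1) (I.reach S (n + 1) p.1).1 p.2) ∂(μ.prod S.G) ≤
      S.invRate₁ * Real.log K := by
    have h := integral_mono (hI.integrable_increment_mul_entropy hS (n + 1) hn.ge)
      (integrable_const (S.invRate₁ * Real.log K)) fun p =>
        mul_le_mul (increment_le hS (n + 1) p.1) (entropy_le_log (hS.q_mem _ _ _))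
          (entropy_nonneg (hS.q_mem _ _ _)) hS.invRate₁_pos.le
    rwa [integral_const, probReal_univ, one_smul] at h
  have hpen : ∑ t ∈ Finset.range S.T, ∫ p, S.increment (I.reach S (t + 1) p.1).1 *
        entropy (S.q (t + 1) (I.reach S (t + 1) p.1).1 p.2) ∂(μ.prod S.G) ≤
      2 * (S.invRate₁ * Real.sqrt (Real.log K)) *
        (∫ ω, Real.sqrt (I.reach S S.T ω).1.cumEnt ∂μ) + S.invRate₁ * Real.log K := by
    rw [show Finset.range S.T = Finset.range (n + 1) by rw [hn], Finset.sum_range_succ,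
      Finset.sum_congr rfl fun t ht => hinc t (Finset.mem_range.mp ht),
      ← integral_finsetSum _ hinci, ← integral_const_mul]
    refine add_le_add (integral_mono (integrable_finsetSum _ hinci) (hsqrt.const_mul _)
      fun ω => ?_) hlast
    exact (sum_increment_mul_ent_le hS hn ω).trans_eq (by ring)
  have hftrl := hI.sum_integral_q_sub_le hS hρ
  have hexp := Finset.sum_le_sum fun t ht =>
    hI.integral_policy_le hS (Finset.mem_range.mp ht)
  rw [Finset.sum_add_distrib, ← Finset.mul_sum] at hexp
  rw [← Finset.mul_sum] at hftrl
  rw [Finset.sum_sub_distrib] at hftrl ⊢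
  have hcoef := mul_le_mul_of_nonneg_left hsum_rate
    (show 0 ≤ 4 * (1 / S.lam + d) by positivity)
  have hnn : 0 ≤ ∑ t ∈ Finset.range S.T, ∫ ω, 1 / (I.reach S t ω).1.invRate ∂μ :=
    Finset.sum_nonneg fun t _ => integral_nonneg fun ω =>
      one_div_nonneg.mpr (hS.invRate_pos _).le
  -- The exploration cost 2/λ and the stability cost 2(1/λ + d) multiply the same sum of rates.
  have hsplit : 2 * (1 / S.lam) * (∑ t ∈ Finset.range S.T, ∫ ω, 1 / (I.reach S t ω).1.invRate ∂μ) +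
      2 * (1 / S.lam + d) * (∑ t ∈ Finset.range S.T, ∫ ω, 1 / (I.reach S t ω).1.invRate ∂μ) ≤
      4 * (1 / S.lam + d) * (∑ t ∈ Finset.range S.T, ∫ ω, 1 / (I.reach S t ω).1.invRate ∂μ) := by
    nlinarith [mul_nonneg hd hnn]
  have hfinal : 4 * (1 / S.lam + d) * (1 / S.invRate₁ * (2 / Real.sqrt (Real.log K)) *
      (1 + Real.log S.T) * ∫ ω, Real.sqrt (I.reach S S.T ω).1.cumEnt ∂μ) =
      8 * (S.rate₁ * (1 / S.lam + d) * ((1 + Real.log S.T) / Real.sqrt (Real.log K))) *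
        ∫ ω, Real.sqrt (I.reach S S.T ω).1.cumEnt ∂μ := by
    rw [Setting.rate₁]; ring
  linarith

/-- Jensen's inequality, in tangent form: √W ≤ W/(4b) + b with b² = log(KT) max(Q̄, 1), which is a
third of the bound on E W. -/
lemma integral_sqrt_cumEnt_le {ρ : 𝒳 → Fin K} (hρ : Measurable ρ) :
    ∫ ω, Real.sqrt (I.reach S S.T ω).1.cumEnt ∂μ ≤
      2 * (Real.sqrt (Real.log (K * S.T)) * max (Real.sqrt (I.Qbar S μ ρ)) 1) := by
  have hlog : 1 ≤ Real.log (K * S.T) := by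
    have h1 : (4 : ℝ) ≤ K * S.T := by
      have := Nat.mul_le_mul hS.two_le_arms hS.two_le_rounds
      exact_mod_cast this
    rw [Real.le_log_iff_exp_le (by linarith)]
    have := Real.exp_one_lt_d9
    linarith
  set l := Real.log (K * S.T) with hl
  set m := max (I.Qbar S μ ρ) 1 with hm
  have hm1 : 1 ≤ m := le_max_right _ _
  have hmQ : I.Qbar S μ ρ ≤ m := le_max_left _ _
  have hmax : max (Real.sqrt (I.Qbar S μ ρ)) 1 = Real.sqrt m := by
    rw [hm, Monotone.map_max fun _ _ h => Real.sqrt_le_sqrt h, Real.sqrt_one]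
  set b := Real.sqrt l * Real.sqrt m with hb
  have hbpos : 0 < b := mul_pos (Real.sqrt_pos.mpr (by linarith)) (Real.sqrt_pos.mpr (by linarith))
  have hbsq : b * b = l * m := by
    rw [hb, mul_mul_mul_comm, Real.mul_self_sqrt (by linarith), Real.mul_self_sqrt (by linarith)]
  have hE := hI.integral_cumEnt_le hS hρ
  -- As Q̄ ≤ m and l, m ≥ 1, the bound m (1 + l) + 1 is at most 3 l m.
  have hE' : ∫ ω, (I.reach S S.T ω).1.cumEnt ∂μ ≤ 3 * (b * b) := by
    rw [hbsq]
    nlinarith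
  rw [hmax]
  have hW := hI.integrable_cumEnt hS
  calc ∫ ω, Real.sqrt (I.reach S S.T ω).1.cumEnt ∂μ
      ≤ ∫ ω, ((I.reach S S.T ω).1.cumEnt * (1 / (4 * b)) + b) ∂μ := by
        refine integral_mono (hI.integrable_sqrt_cumEnt hS)
          ((hW.mul_const _).add (integrable_const _)) fun ω => ?_
        have h := hS.log_arms_pos.le.trans (log_arms_le_cumEnt (I := I) hS ω)
        have h2 := Real.mul_self_sqrt h
        simp only
        rw [← sub_nonneg]
        have h3 : (I.reach S S.T ω).1.cumEnt * (1 / (4 * b)) + b -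
            Real.sqrt (I.reach S S.T ω).1.cumEnt =
            (Real.sqrt (I.reach S S.T ω).1.cumEnt - 2 * b) ^ 2 / (4 * b) := by
          field_simp
          nlinarith
        rw [h3]
        positivity
    _ = (∫ ω, (I.reach S S.T ω).1.cumEnt ∂μ) * (1 / (4 * b)) + b := by
        rw [integral_add (hW.mul_const _) (integrable_const _), integral_mul_const,
          integral_const, probReal_univ, one_smul]
    _ ≤ 3 * (b * b) * (1 / (4 * b)) + b := by gcongr
    _ ≤ 2 * b := by
        have : 3 * (b * b) * (1 / (4 * b)) = 3 / 4 * b := by field_simp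
        linarith

lemma regret_le {ρ : 𝒳 → Fin K} (hρ : I.IsOptimal S μ ρ) :
    I.regret S μ ≤
      48 * ((S.rate₁ * (1 / S.lam + d) * (Real.log S.T / Real.sqrt (Real.log K)) +
          1 / S.rate₁ * Real.sqrt (Real.log K)) *
        Real.sqrt (Real.log (K * S.T)) * max (Real.sqrt (I.Qbar S μ ρ)) 1) := by
  have h1 := (hI.regret_le_of_isOptimal hS hρ).trans (hI.sum_regret_le hS hρ.1)
  have h2 := hI.integral_sqrt_cumEnt_le hS hρ.1
  set Y := Real.sqrt (Real.log (K * S.T)) * max (Real.sqrt (I.Qbar S μ ρ)) 1 with hY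
  have hK := hS.log_arms_pos
  have hβ := hS.invRate₁_pos
  have hT : Real.log 2 ≤ Real.log S.T :=
    Real.log_le_log (by norm_num) (by exact_mod_cast hS.two_le_rounds)
  have hlog2 := Real.log_two_gt_d9
  have hrate : 0 < S.rate₁ := one_div_pos.mpr hβ
  have hrate' : 1 / S.rate₁ = S.invRate₁ := one_div_one_div _
  have hlam : 0 < 1 / S.lam := one_div_pos.mpr hS.lam_pos
  have hc : 0 ≤ S.rate₁ * (1 / S.lam + d) := by positivity
  have hsK := Real.sqrt_pos.mpr hK
  -- This absorbs the additive term 2 (1/η_1) log K into 2 R Y.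
  have hKY : Real.sqrt (Real.log K) ≤ Y := by
    have hT1 : (1 : ℝ) ≤ S.T := by
      have := hS.two_le_rounds
      exact_mod_cast (by omega : 1 ≤ S.T)
    have hK0 : (0 : ℝ) < K := by have := hS.two_le_arms; positivity
    have h3 : Real.sqrt (Real.log K) ≤ Real.sqrt (Real.log (K * S.T)) :=
      Real.sqrt_le_sqrt (Real.log_le_log hK0 (le_mul_of_one_le_right hK0.le hT1))
    exact h3.trans (le_mul_of_one_le_right (Real.sqrt_nonneg _) (le_max_right _ _))
  have hY0 : 0 < Y := hsK.trans_le hKY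
  have h3 : S.invRate₁ * Real.log K ≤ S.invRate₁ * Real.sqrt (Real.log K) * Y := by
    rw [mul_assoc]
    refine mul_le_mul_of_nonneg_left ?_ hβ.le
    calc Real.log K = Real.sqrt (Real.log K) * Real.sqrt (Real.log K) :=
          (Real.mul_self_sqrt hK.le).symm
      _ ≤ _ := mul_le_mul_of_nonneg_left hKY hsK.le
  -- The factor 3 comes from 1 ≤ 2 log T, valid because log 2 > 1/2.
  have h4 : S.rate₁ * (1 / S.lam + d) * ((1 + Real.log S.T) / Real.sqrt (Real.log K)) ≤
      3 * (S.rate₁ * (1 / S.lam + d) * (Real.log S.T / Real.sqrt (Real.log K))) := by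
    have h : (1 + Real.log S.T) / Real.sqrt (Real.log K) ≤
        3 * (Real.log S.T / Real.sqrt (Real.log K)) := by
      rw [← mul_div_assoc]
      gcongr
      linarith
    exact (mul_le_mul_of_nonneg_left h hc).trans_eq (by ring)
  set P := S.rate₁ * (1 / S.lam + d) * (Real.log S.T / Real.sqrt (Real.log K)) with hP
  have hP0 : 0 ≤ P := mul_nonneg hc (div_nonneg (by linarith) hsK.le)
  set R := S.invRate₁ * Real.sqrt (Real.log K) with hR
  have hR0 : 0 < R := mul_pos hβ hsK
  have h5 : (2 * R + 8 * (S.rate₁ * (1 / S.lam + d) *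
      ((1 + Real.log S.T) / Real.sqrt (Real.log K)))) *
        ∫ ω, Real.sqrt (I.reach S S.T ω).1.cumEnt ∂μ ≤ (2 * R + 8 * (3 * P)) * (2 * Y) :=
    mul_le_mul (by linarith) h2 (integral_nonneg fun ω => Real.sqrt_nonneg _) (by positivity)
  rw [hrate', mul_assoc, ← hY]
  -- In total 2RY + (2R + 24P) · 2Y = 6RY + 48PY, whence the constant 48.
  nlinarith [mul_pos hR0 hY0]

end IsRun

end Interaction

end Rounds

end LinBandit

end

theorem mainTheorem6 :
    ∃ C : ℝ, 0 < C ∧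
      ∀ {Ω 𝒳 : Type*} [MeasurableSpace Ω] [MeasurableSpace 𝒳] (μ : Measure Ω)
        [IsProbabilityMeasure μ] (K d : ℕ) (S : LinBandit.Setting 𝒳 K d)
        (I : LinBandit.Interaction Ω 𝒳 K d) (𝒵 Θ : Set (Fin d → ℝ)),
        2 ≤ K → 2 ≤ S.T →
        S.Admissible 𝒵 →
        S.rate₁ / S.lam ≤ 1 →
        I.IsRun S μ 𝒵 Θ →
        (∃ ρ, I.IsOptimal S μ ρ) ∧
        ∀ ρ, I.IsOptimal S μ ρ →
          I.regret S μ ≤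
            C * ((S.rate₁ * (1 / S.lam + d) * (Real.log S.T / Real.sqrt (Real.log K)) +
                  1 / S.rate₁ * Real.sqrt (Real.log K)) *
                Real.sqrt (Real.log (K * S.T)) *
                max (Real.sqrt (I.Qbar S μ ρ)) 1) := by
  refine ⟨48, by norm_num, ?_⟩
  intro Ω 𝒳 _ _ μ _ K d S I 𝒵 Θ hK hT hS hγ hI
  have hS' : S.Regular 𝒵 := ⟨hS, hK, hT, hγ⟩
  exact ⟨hI.exists_isOptimal hS', fun ρ hρ => hI.regret_le hS' hρ⟩
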